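/- Let $n\ge 1$ and let $\mathbb F$ be a field of characteristic $0$ (for instance $\mathbb C$). Let $\mathcal A_n$ be the space of rational functions $L(x)/\prod_{1\le i<j\le n}(1-x_j/x_i)^{q_{ij}}$, where $L$ is a Laurent polynomial in $x_1,\dots,x_n$ over $\mathbb F$, homogeneous of degree $0$, and the $q_{ij}$ are nonnegative integers. For $i\ne j$, let $[i,j]$ be the linear operator on $\mathcal A_n$ defined as follows: if $$F=L_1(x_i)+\sum_{u\ne i}\frac{A_u(x_i)}{(1-x_i/x_u)^{q_u}}$$ is the partial fraction decomposition of $F$ with respect to $x_i$ ($L_1$ a Laurent polynomial in $x_i$, $A_u$ a polynomial in $x_i$ of degree less than $q_u$, with coefficients not involving $x_i$), then $[i,j]F=A_j(0)$. Let $\Xi$ be the unital $\mathbb F$-algebra of linear operators on $\mathcal A_n$ generated by all $[i,j]$ with $i\neq j$. A monomial operator of degree $s$ is a nonzero product $[i_s,j_s]\cdots[i_1,j_1]$ (for $s=0$, the identity), and $\Xi^s$ is the span of all monomial operators of degree $s$. An ordered directed rooted forest on $\{1,\dots,n\}$ is a forest, possibly with isolated vertices, each of whose components has a root towards which all its edges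 are directed, together with a left-to-right order on the children $u$ (edges $u\to v$) of each vertex $v$. The realization of such a tree is the product of the $[i,j]$ over its edges $i\to j$, written from left to right in the order obtained by reading the edges level by level from the root, each level from left to right; the realization $L(D)$ of a forest $D$ is the product of the realizations of its trees. A forest is increasing if $i>j$ for each edge $i\to j$; it is nearly increasing if $i>j$ for each edge $i\to j$ such that $j$ is not a root; it is augmented if the children of each vertex have increasing labels from left to right. For $0\le s\le n-2$ let $B^s$ be the set of all $L(D)$, where $D$ is an augmented nearly increasing forest on $\{1,\dots,n\}$ with $n-s$ components (equivalently, with $s$ edges). Let $B^{n-1}$ be the set of all $L(T)$, where $T$ is an augmented increasing tree on $\{1,\dots,n\}$. Then $$\Xi=\bigoplus_{s=0}^{n-1}\Xi^s=\bigoplus_{s=0}^{n-1}\operatorname{span}(B^s),$$ and $\Xi^s=\operatorname{span}(B^s)$ for every $s=0,\dots,n-1$. -/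

import Mathlib

open scoped Polynomial

noncomputable section

namespace CTAlg

/-! ### Rational functions of type A -/

/-- The field of rational functions in `n` variables with coefficients in `𝔽`. The variables
`x_1, …, x_n` of the mathematics are indexed by `Fin n`, in the same order. -/
abbrev RatFun (𝔽 : Type*) [Field 𝔽] (n : ℕ) : Type _ := FractionRing (MvPolynomial (Fin n) 𝔽)

/-- The variable `x_i`, as a rational function. -/
def x (𝔽 : Type*) [Field 𝔽] {n : ℕ} (i : Fin n) : RatFun 𝔽 n :=
  algebraMap (MvPolynomial (Fin n) 𝔽) (RatFun 𝔽 n) (MvPolynomial.X i)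

/-- The space of Laurent polynomials in `x_1, …, x_n` that are homogeneous of degree `0`. -/
def laurentZero (𝔽 : Type*) [Field 𝔽] (n : ℕ) : Submodule 𝔽 (RatFun 𝔽 n) :=
  Submodule.span 𝔽 {f | ∃ a : Fin n → ℤ, ∑ i, a i = 0 ∧ f = ∏ i, x 𝔽 i ^ a i}

/-- The product of the `(1 - x_j / x_i) ^ q_{ij}` over all pairs `i < j`. -/
def denom (𝔽 : Type*) [Field 𝔽] {n : ℕ} (q : Fin n → Fin n → ℕ) : RatFun 𝔽 n :=
  ∏ i, ∏ j ∈ Finset.Ioi i, (1 - x 𝔽 j / x 𝔽 i) ^ q i j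

theorem x_ne_zero (𝔽 : Type*) [Field 𝔽] {n : ℕ} (i : Fin n) : x 𝔽 i ≠ 0 := by
  unfold x
  rw [Ne, FaithfulSMul.algebraMap_eq_zero_iff]
  exact MvPolynomial.X_ne_zero i

theorem x_injective (𝔽 : Type*) [Field 𝔽] {n : ℕ} : Function.Injective (x 𝔽 (n := n)) := by
  intro i j h
  exact MvPolynomial.X_injective (FaithfulSMul.algebraMap_injective _ _ h)

theorem one_sub_ne_zero (𝔽 : Type*) [Field 𝔽] {n : ℕ} {i j : Fin n} (h : i ≠ j) :
    1 - x 𝔽 i / x 𝔽 j ≠ 0 := by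
  intro h0
  have h1 : x 𝔽 i / x 𝔽 j = 1 := (sub_eq_zero.mp h0).symm
  rw [div_eq_one_iff_eq (x_ne_zero 𝔽 j)] at h1
  exact h (x_injective 𝔽 h1)

theorem denom_ne_zero (𝔽 : Type*) [Field 𝔽] {n : ℕ} (q : Fin n → Fin n → ℕ) :
    denom 𝔽 q ≠ 0 := by
  refine Finset.prod_ne_zero_iff.mpr fun i _ => Finset.prod_ne_zero_iff.mpr fun j hj => ?_
  exact pow_ne_zero _ (one_sub_ne_zero 𝔽 (Finset.mem_Ioi.mp hj).ne')

theorem denom_add (𝔽 : Type*) [Field 𝔽] {n : ℕ} (q q' : Fin n → Fin n → ℕ) :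
    denom 𝔽 (q + q') = denom 𝔽 q * denom 𝔽 q' := by
  simp [denom, pow_add, Finset.prod_mul_distrib]

theorem laurentZero_mul (𝔽 : Type*) [Field 𝔽] {n : ℕ} {f g : RatFun 𝔽 n}
    (hf : f ∈ laurentZero 𝔽 n) (hg : g ∈ laurentZero 𝔽 n) : f * g ∈ laurentZero 𝔽 n := by
  have h := Submodule.mul_mem_mul hf hg
  rw [laurentZero, Submodule.span_mul_span] at h
  refine Submodule.span_mono ?_ h
  rintro _ ⟨_, ⟨a, ha, rfl⟩, _, ⟨b, hb, rfl⟩, rfl⟩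
  refine ⟨a + b, by simp [Finset.sum_add_distrib, ha, hb], ?_⟩
  simp [zpow_add₀ (x_ne_zero 𝔽 _), Finset.prod_mul_distrib]

theorem one_mem_laurentZero (𝔽 : Type*) [Field 𝔽] (n : ℕ) : 1 ∈ laurentZero 𝔽 n :=
  Submodule.subset_span ⟨0, by simp, by simp⟩

theorem div_mem_laurentZero (𝔽 : Type*) [Field 𝔽] {n : ℕ} (i j : Fin n) :
    x 𝔽 i / x 𝔽 j ∈ laurentZero 𝔽 n := by
  refine Submodule.subset_span ⟨Pi.single i 1 - Pi.single j 1, by simp, ?_⟩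
  simp only [Pi.sub_apply, zpow_sub₀ (x_ne_zero 𝔽 _), Finset.prod_div_distrib]
  congr 1
  · rw [Finset.prod_eq_single i] <;> simp +contextual
  · rw [Finset.prod_eq_single j] <;> simp +contextual

theorem denom_mem_laurentZero (𝔽 : Type*) [Field 𝔽] {n : ℕ} (q : Fin n → Fin n → ℕ) :
    denom 𝔽 q ∈ laurentZero 𝔽 n := by
  let S : Submonoid (RatFun 𝔽 n) :=
    { carrier := laurentZero 𝔽 n
      mul_mem' := laurentZero_mul 𝔽
      one_mem' := one_mem_laurentZero 𝔽 n }
  change denom 𝔽 q ∈ S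
  refine S.prod_mem fun i _ => S.prod_mem fun j _ => S.pow_mem ?_ _
  exact (laurentZero 𝔽 n).sub_mem (one_mem_laurentZero 𝔽 n) (div_mem_laurentZero 𝔽 j i)

/-- `𝒜_n`: the rational functions `L(x) / ∏_{i<j} (1 - x_j / x_i) ^ q_{ij}`, where `L` is a
homogeneous Laurent polynomial of degree `0` and the `q_{ij}` are nonnegative integers. -/
def typeA (𝔽 : Type*) [Field 𝔽] (n : ℕ) : Subalgebra 𝔽 (RatFun 𝔽 n) where
  carrier := {F | ∃ L ∈ laurentZero 𝔽 n, ∃ q : Fin n → Fin n → ℕ, F = L / denom 𝔽 q}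
  mul_mem' := by
    rintro _ _ ⟨L, hL, q, rfl⟩ ⟨L', hL', q', rfl⟩
    exact ⟨L * L', laurentZero_mul 𝔽 hL hL', q + q', by rw [denom_add, div_mul_div_comm]⟩
  add_mem' := by
    rintro _ _ ⟨L, hL, q, rfl⟩ ⟨L', hL', q', rfl⟩
    refine ⟨L * denom 𝔽 q' + denom 𝔽 q * L', ?_, q + q', ?_⟩
    · exact (laurentZero 𝔽 n).add_mem (laurentZero_mul 𝔽 hL (denom_mem_laurentZero 𝔽 q'))
        (laurentZero_mul 𝔽 (denom_mem_laurentZero 𝔽 q) hL')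
    · rw [denom_add, div_add_div _ _ (denom_ne_zero 𝔽 q) (denom_ne_zero 𝔽 q')]
  algebraMap_mem' := by
    intro c
    refine ⟨c • 1, (laurentZero 𝔽 n).smul_mem c (one_mem_laurentZero 𝔽 n), 0, ?_⟩
    simp [denom, Algebra.smul_def]

/-! ### Partial fractions and the constant term operators -/

/-- The field of the rational functions that do not involve `x_i`. -/
def freeOf (𝔽 : Type*) [Field 𝔽] {n : ℕ} (i : Fin n) : IntermediateField 𝔽 (RatFun 𝔽 n) :=
  IntermediateField.adjoin 𝔽 (x 𝔽 '' {l | l ≠ i})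

/-- `F = L + ∑_{u ≠ i} A_u(x_i) / (1 - x_i / x_u) ^ q_u` is the partial fraction decomposition of
`F` with respect to `x_i`: here `L` is a Laurent polynomial in `x_i` and `A_u` is a polynomial in
`x_i` of degree less than `q_u`, all with coefficients that do not involve `x_i`. An index `u` at
which there is no pole has `q_u = 0`, and then `A_u = 0`. -/
structure IsPFD {𝔽 : Type*} [Field 𝔽] {n : ℕ} (i : Fin n) (F L : RatFun 𝔽 n)
    (q : Fin n → ℕ) (A : Fin n → (freeOf 𝔽 i)[X]) : Prop where
  laurent : L ∈ Submodule.span (freeOf 𝔽 i) (Set.range fun k : ℤ => x 𝔽 i ^ k)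
  degree_lt : ∀ u, u ≠ i → (A u).degree < (q u : WithBot ℕ)
  eq : F = L + ∑ u ∈ Finset.univ.erase i,
    Polynomial.aeval (x 𝔽 i) (A u) / (1 - x 𝔽 i / x 𝔽 u) ^ q u

/-- `c` is the constant term of `F` at `x_i = x_j`: it is the value `A_j(0)` for a partial fraction
decomposition of `F` with respect to `x_i`. -/
def HasCT {𝔽 : Type*} [Field 𝔽] {n : ℕ} (i j : Fin n) (F c : RatFun 𝔽 n) : Prop :=
  ∃ L q A, IsPFD i F L q A ∧ c = ((A j).eval 0 : freeOf 𝔽 i)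

theorem x_mem_freeOf (𝔽 : Type*) [Field 𝔽] {n : ℕ} {i u : Fin n} (h : u ≠ i) :
    x 𝔽 u ∈ freeOf 𝔽 i :=
  IntermediateField.subset_adjoin _ _ ⟨u, h, rfl⟩

/-- `1 - X / x_u`, as a polynomial in `X = x_i` (for `u ≠ i`). -/
def poleFactor (𝔽 : Type*) [Field 𝔽] {n : ℕ} (i u : Fin n) : (freeOf 𝔽 i)[X] :=
  open Classical in
  1 - Polynomial.C (if h : x 𝔽 u ∈ freeOf 𝔽 i then (⟨x 𝔽 u, h⟩⁻¹ : freeOf 𝔽 i) else 0) *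
    Polynomial.X

theorem aeval_poleFactor (𝔽 : Type*) [Field 𝔽] {n : ℕ} {i u : Fin n} (h : u ≠ i) :
    Polynomial.aeval (x 𝔽 i) (poleFactor 𝔽 i u) = 1 - x 𝔽 i / x 𝔽 u := by
  simp [poleFactor, x_mem_freeOf 𝔽 h, div_eq_inv_mul, IntermediateField.algebraMap_apply]

theorem eval_poleFactor (𝔽 : Type*) [Field 𝔽] {n : ℕ} (i u : Fin n) :
    (poleFactor 𝔽 i u).eval 0 = 1 := by
  simp [poleFactor]

theorem natDegree_poleFactor_le (𝔽 : Type*) [Field 𝔽] {n : ℕ} (i u : Fin n) :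
    (poleFactor 𝔽 i u).natDegree ≤ 1 := by
  unfold poleFactor
  compute_degree!

theorem degree_poleFactor (𝔽 : Type*) [Field 𝔽] {n : ℕ} {i u : Fin n} (h : u ≠ i) :
    (poleFactor 𝔽 i u).degree = 1 := by
  have h0 : (⟨x 𝔽 u, x_mem_freeOf 𝔽 h⟩⁻¹ : freeOf 𝔽 i) ≠ 0 :=
    inv_ne_zero fun h0 => x_ne_zero 𝔽 u (congrArg Subtype.val h0)
  rw [poleFactor, dif_pos (x_mem_freeOf 𝔽 h), Polynomial.degree_sub_eq_right_of_degree_lt]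
  · rw [Polynomial.degree_C_mul_X h0]
  · rw [Polynomial.degree_C_mul_X h0, Polynomial.degree_one]
    exact zero_lt_one

theorem isCoprime_poleFactor_X (𝔽 : Type*) [Field 𝔽] {n : ℕ} (i u : Fin n) :
    IsCoprime (poleFactor 𝔽 i u) Polynomial.X := by
  refine ⟨1, Polynomial.C (open Classical in
    if h : x 𝔽 u ∈ freeOf 𝔽 i then (⟨x 𝔽 u, h⟩⁻¹ : freeOf 𝔽 i) else 0), ?_⟩
  rw [poleFactor]
  ring

theorem isCoprime_poleFactor (𝔽 : Type*) [Field 𝔽] {n : ℕ} {i u v : Fin n} (hu : u ≠ i)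
    (hv : v ≠ i) (h : u ≠ v) : IsCoprime (poleFactor 𝔽 i u) (poleFactor 𝔽 i v) := by
  let a : freeOf 𝔽 i := ⟨x 𝔽 u, x_mem_freeOf 𝔽 hu⟩
  let b : freeOf 𝔽 i := ⟨x 𝔽 v, x_mem_freeOf 𝔽 hv⟩
  have ha : a ≠ 0 := fun h0 => x_ne_zero 𝔽 u (congrArg Subtype.val h0)
  have hb : b ≠ 0 := fun h0 => x_ne_zero 𝔽 v (congrArg Subtype.val h0)
  have hab : a - b ≠ 0 := sub_ne_zero.mpr fun h0 =>
    h (x_injective 𝔽 (congrArg Subtype.val h0))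
  refine ⟨Polynomial.C ((a - b)⁻¹ * a), Polynomial.C (-((a - b)⁻¹ * b)), ?_⟩
  rw [poleFactor, poleFactor, dif_pos (x_mem_freeOf 𝔽 hu), dif_pos (x_mem_freeOf 𝔽 hv)]
  change Polynomial.C ((a - b)⁻¹ * a) * (1 - Polynomial.C a⁻¹ * Polynomial.X) +
    Polynomial.C (-((a - b)⁻¹ * b)) * (1 - Polynomial.C b⁻¹ * Polynomial.X) = 1
  have e1 : (a - b)⁻¹ * a - (a - b)⁻¹ * b = 1 := by field_simp
  have e2 : (a - b)⁻¹ * a * a⁻¹ - (a - b)⁻¹ * b * b⁻¹ = 0 := by field_simp; ring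
  have e1' := congrArg Polynomial.C e1
  have e2' := congrArg Polynomial.C e2
  simp only [map_sub, map_mul, map_one, map_zero, map_neg] at e1' e2' ⊢
  linear_combination e1' - Polynomial.X * e2'

theorem transcendental_x (𝔽 : Type*) [Field 𝔽] {n : ℕ} (i : Fin n) :
    Transcendental (freeOf 𝔽 i) (x 𝔽 i) := by
  have h : AlgebraicIndependent 𝔽 (x 𝔽 (n := n)) :=
    (MvPolynomial.algebraicIndependent_X (Fin n) 𝔽).map'
      (f := IsScalarTower.toAlgHom 𝔽 (MvPolynomial (Fin n) 𝔽) (RatFun 𝔽 n))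
      (FaithfulSMul.algebraMap_injective _ _)
  have h2 := h.transcendental_adjoin (s := {l | l ≠ i}) (i := i) (by simp)
  exact IntermediateField.transcendental_adjoin_iff.mpr h2

theorem HasCT.smul_add {𝔽 : Type*} [Field 𝔽] {n : ℕ} {i j : Fin n} {F F' c c' : RatFun 𝔽 n}
    (b : freeOf 𝔽 i) (h : HasCT i j F c) (h' : HasCT i j F' c') :
    HasCT i j ((b : RatFun 𝔽 n) * F + F') (b * c + c') := by
  obtain ⟨L, q, A, hA, rfl⟩ := h
  obtain ⟨L', q', A', hA', rfl⟩ := h'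
  refine ⟨b * L + L', q + q', fun u => Polynomial.C b * (A u * poleFactor 𝔽 i u ^ q' u) +
    A' u * poleFactor 𝔽 i u ^ q u, ⟨?_, ?_, ?_⟩, ?_⟩
  · exact Submodule.add_mem _ (Submodule.smul_mem _ b hA.laurent) hA'.laurent
  · intro u hu
    have key : ∀ (P : (freeOf 𝔽 i)[X]) (k l : ℕ), P.degree < (k : WithBot ℕ) →
        (P * poleFactor 𝔽 i u ^ l).degree < ((k + l : ℕ) : WithBot ℕ) := by
      intro P k l hP
      rcases eq_or_ne P 0 with rfl | hP0
      · simp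
      · rw [Polynomial.degree_mul, Polynomial.degree_pow, degree_poleFactor 𝔽 hu]
        rw [Polynomial.degree_eq_natDegree hP0] at hP ⊢
        rw [nsmul_one, ← Nat.cast_add, Nat.cast_lt]
        exact Nat.add_lt_add_right (by exact_mod_cast hP) l
    refine (Polynomial.degree_add_le _ _).trans_lt (max_lt ?_ ?_)
    · rw [← Polynomial.smul_eq_C_mul]
      refine (Polynomial.degree_smul_le _ _).trans_lt ?_
      exact key _ _ _ (hA.degree_lt u hu)
    · have := key _ _ (q u) (hA'.degree_lt u hu)
      rwa [add_comm (q' u)] at this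
  · have e : ∀ u ∈ Finset.univ.erase i,
        Polynomial.aeval (x 𝔽 i) (Polynomial.C b * (A u * poleFactor 𝔽 i u ^ q' u) +
          A' u * poleFactor 𝔽 i u ^ q u) / (1 - x 𝔽 i / x 𝔽 u) ^ (q + q') u =
        (b : RatFun 𝔽 n) * (Polynomial.aeval (x 𝔽 i) (A u) / (1 - x 𝔽 i / x 𝔽 u) ^ q u) +
          Polynomial.aeval (x 𝔽 i) (A' u) / (1 - x 𝔽 i / x 𝔽 u) ^ q' u := by
      intro u hu
      have hu' : u ≠ i := (Finset.mem_erase.mp hu).1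
      have h0 := one_sub_ne_zero 𝔽 hu'.symm
      simp only [map_add, map_mul, map_pow, aeval_poleFactor 𝔽 hu', Polynomial.aeval_C,
        Pi.add_apply, pow_add]
      rw [IntermediateField.algebraMap_apply]
      generalize 1 - x 𝔽 i / x 𝔽 u = d at h0
      field_simp
    rw [Finset.sum_congr rfl e, Finset.sum_add_distrib, ← Finset.mul_sum]
    conv_lhs => rw [hA.eq, hA'.eq]
    ring
  · simp [eval_poleFactor]

theorem hasCT_of_laurent {𝔽 : Type*} [Field 𝔽] {n : ℕ} (i j : Fin n) {L : RatFun 𝔽 n}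
    (hL : L ∈ Submodule.span (freeOf 𝔽 i) (Set.range fun k : ℤ => x 𝔽 i ^ k)) :
    HasCT i j L 0 :=
  ⟨L, 0, 0, ⟨hL, fun u _ => by simp, by simp⟩, by simp⟩

theorem hasCT_zero {𝔽 : Type*} [Field 𝔽] {n : ℕ} (i j : Fin n) :
    HasCT i j (0 : RatFun 𝔽 n) 0 :=
  hasCT_of_laurent i j (Submodule.zero_mem _)

theorem hasCT_pole {𝔽 : Type*} [Field 𝔽] {n : ℕ} (i j : Fin n) {u : Fin n} (hu : u ≠ i)
    {k : ℕ} (hk : 0 < k) :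
    HasCT i j (((1 - x 𝔽 i / x 𝔽 u) ^ k)⁻¹) (if u = j then 1 else 0) := by
  refine ⟨0, Pi.single u k, Pi.single u 1, ⟨Submodule.zero_mem _, ?_, ?_⟩, ?_⟩
  · intro v hv
    rcases eq_or_ne v u with rfl | hvu
    · simpa using hk
    · simp [hvu]
  · rw [Finset.sum_eq_single_of_mem u (by simp [hu])]
    · simp
    · intro v _ hvu
      simp [hvu]
  · rcases eq_or_ne u j with rfl | huj
    · simp
    · simp [huj, huj.symm]

theorem exists_polynomial_of_laurent {𝔽 : Type*} [Field 𝔽] {n : ℕ} {i : Fin n} {L : RatFun 𝔽 n}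
    (hL : L ∈ Submodule.span (freeOf 𝔽 i) (Set.range fun k : ℤ => x 𝔽 i ^ k)) :
    ∃ (N : ℕ) (P : (freeOf 𝔽 i)[X]), x 𝔽 i ^ N * L = Polynomial.aeval (x 𝔽 i) P := by
  induction hL using Submodule.span_induction with
  | mem y hy =>
    obtain ⟨k, rfl⟩ := hy
    refine ⟨k.natAbs, Polynomial.X ^ (k.natAbs + k).toNat, ?_⟩
    have : (0 : ℤ) ≤ k.natAbs + k := by omega
    simp only [map_pow, Polynomial.aeval_X]
    rw [← zpow_natCast, ← zpow_natCast, Int.toNat_of_nonneg this,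
      zpow_add₀ (x_ne_zero 𝔽 i)]
  | zero => exact ⟨0, 0, by simp⟩
  | add y z _ _ hy hz =>
    obtain ⟨N, P, hP⟩ := hy
    obtain ⟨M, Q, hQ⟩ := hz
    refine ⟨N + M, Polynomial.X ^ M * P + Polynomial.X ^ N * Q, ?_⟩
    simp only [map_add, map_mul, map_pow, Polynomial.aeval_X, ← hP, ← hQ]
    ring
  | smul b y _ hy =>
    obtain ⟨N, P, hP⟩ := hy
    refine ⟨N, Polynomial.C b * P, ?_⟩
    rw [map_mul, ← hP, Polynomial.aeval_C, Algebra.smul_def]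
    ring

theorem HasCT.eq_zero {𝔽 : Type*} [Field 𝔽] {n : ℕ} {i j : Fin n} (hij : j ≠ i)
    {c : RatFun 𝔽 n} (h : HasCT i j 0 c) : c = 0 := by
  obtain ⟨L, q, A, hA, rfl⟩ := h
  obtain ⟨N, P, hP⟩ := exists_polynomial_of_laurent hA.laurent
  set s : Finset (Fin n) := Finset.univ.erase i with hs
  set g : Fin n → (freeOf 𝔽 i)[X] := fun u => poleFactor 𝔽 i u ^ q u with hg
  have hjs : j ∈ s := by simp [hs, hij]
  have hpoly : P * ∏ u ∈ s, g u +
      Polynomial.X ^ N * ∑ u ∈ s, A u * ∏ v ∈ s.erase u, g v = 0 := by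
    have hinj := transcendental_iff_injective.mp (transcendental_x 𝔽 i)
    apply hinj
    have hgu : ∀ u ∈ s, Polynomial.aeval (x 𝔽 i) (g u) = (1 - x 𝔽 i / x 𝔽 u) ^ q u := by
      intro u hu
      rw [hg, map_pow, aeval_poleFactor 𝔽 (Finset.mem_erase.mp hu).1]
    have hsum : ∀ u ∈ s, Polynomial.aeval (x 𝔽 i) (A u * ∏ v ∈ s.erase u, g v) =
        Polynomial.aeval (x 𝔽 i) (A u) / (1 - x 𝔽 i / x 𝔽 u) ^ q u *
          Polynomial.aeval (x 𝔽 i) (∏ u ∈ s, g u) := by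
      intro u hu
      have h0 := pow_ne_zero (q u) (one_sub_ne_zero 𝔽 (Finset.mem_erase.mp hu).1.symm)
      rw [← Finset.mul_prod_erase s g hu, map_mul, map_mul, hgu u hu]
      field_simp
    rw [map_add, map_mul, map_mul, map_pow, Polynomial.aeval_X, map_sum, map_zero,
      Finset.sum_congr rfl hsum, ← Finset.sum_mul, ← hP]
    have := hA.eq
    linear_combination (-(x 𝔽 i ^ N * Polynomial.aeval (x 𝔽 i) (∏ u ∈ s, g u))) * this
  have hdvd : g j ∣ A j * (Polynomial.X ^ N * ∏ v ∈ s.erase j, g v) := by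
    rw [← Finset.add_sum_erase s _ hjs, ← Finset.mul_prod_erase s g hjs] at hpoly
    have hd : g j ∣ ∑ u ∈ s.erase j, A u * ∏ v ∈ s.erase u, g v := by
      refine Finset.dvd_sum fun u hu => Dvd.dvd.mul_left (Finset.dvd_prod_of_mem g ?_) _
      exact Finset.mem_erase.mpr ⟨(Finset.mem_erase.mp hu).1.symm, hjs⟩
    obtain ⟨r, hr⟩ := hd
    rw [hr] at hpoly
    refine ⟨-(P * ∏ u ∈ s.erase j, g u + Polynomial.X ^ N * r), ?_⟩
    linear_combination hpoly
  have hcop : IsCoprime (g j) (Polynomial.X ^ N * ∏ v ∈ s.erase j, g v) := by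
    refine IsCoprime.mul_right (isCoprime_poleFactor_X 𝔽 i j).pow (IsCoprime.prod_right ?_)
    intro v hv
    obtain ⟨hvj, hvs⟩ := Finset.mem_erase.mp hv
    exact (isCoprime_poleFactor 𝔽 hij (Finset.mem_erase.mp hvs).1 hvj.symm).pow
  have hdeg : (A j).degree < (g j).degree := by
    rw [hg, Polynomial.degree_pow, degree_poleFactor 𝔽 hij, nsmul_one]
    exact hA.degree_lt j hij
  rw [Polynomial.eq_zero_of_dvd_of_degree_lt (hcop.dvd_of_dvd_mul_right hdvd) hdeg]
  simp

/-- The constant term at `x_i = x_j` is unique. -/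
theorem HasCT.unique {𝔽 : Type*} [Field 𝔽] {n : ℕ} {i j : Fin n} (hij : j ≠ i)
    {F c c' : RatFun 𝔽 n} (h : HasCT i j F c) (h' : HasCT i j F c') : c = c' := by
  have h0 := h.smul_add (-1) h'
  have e : ((-1 : freeOf 𝔽 i) : RatFun 𝔽 n) = -1 := by simp
  rw [e, neg_one_mul, neg_one_mul, neg_add_cancel] at h0
  have := h0.eq_zero hij
  linear_combination -this

theorem div_mem_typeA (𝔽 : Type*) [Field 𝔽] {n : ℕ} (u v : Fin n) :
    x 𝔽 u / x 𝔽 v ∈ typeA 𝔽 n :=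
  ⟨_, div_mem_laurentZero 𝔽 u v, 0, by simp [denom]⟩

theorem inv_mem_typeA (𝔽 : Type*) [Field 𝔽] {n : ℕ} {u v : Fin n} (h : u ≠ v) :
    (1 - x 𝔽 u / x 𝔽 v)⁻¹ ∈ typeA 𝔽 n := by
  have key : ∀ u v : Fin n, v < u → (1 - x 𝔽 u / x 𝔽 v)⁻¹ ∈ typeA 𝔽 n := by
    intro u v h
    refine ⟨1, one_mem_laurentZero 𝔽 n, fun a b => if a = v ∧ b = u then 1 else 0, ?_⟩
    rw [denom, Finset.prod_eq_single_of_mem v (Finset.mem_univ v),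
      Finset.prod_eq_single_of_mem u (Finset.mem_Ioi.mpr h)]
    · simp
    · intro b _ hb
      simp [hb]
    · intro a _ ha
      simp [ha]
  rcases lt_or_gt_of_ne h with h1 | h1
  · have h2 : (1 - x 𝔽 u / x 𝔽 v)⁻¹ = 1 - (1 - x 𝔽 v / x 𝔽 u)⁻¹ := by
      have a1 := one_sub_ne_zero 𝔽 h
      have a2 := one_sub_ne_zero 𝔽 h.symm
      have a3 := x_ne_zero 𝔽 u
      have a4 := x_ne_zero 𝔽 v
      have a5 : x 𝔽 v - x 𝔽 u ≠ 0 := sub_ne_zero.mpr fun e => h (x_injective 𝔽 e.symm)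
      have a6 : x 𝔽 u - x 𝔽 v ≠ 0 := sub_ne_zero.mpr fun e => h (x_injective 𝔽 e)
      rw [one_sub_div a4, one_sub_div a3, inv_div, inv_div]
      field_simp
      ring
    rw [h2]
    exact (typeA 𝔽 n).sub_mem (typeA 𝔽 n).one_mem (key v u h1)
  · exact key u v h1

/-- The elements of `𝒜_n` that do not involve `x_i`. -/
def coeffAlg (𝔽 : Type*) [Field 𝔽] {n : ℕ} (i : Fin n) : Subalgebra 𝔽 (RatFun 𝔽 n) :=
  typeA 𝔽 n ⊓ (freeOf 𝔽 i).toSubalgebra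

/-- The span, over the elements of `𝒜_n` not involving `x_i`, of the powers of `x_i / x_j` and of
the `1 / (1 - x_i / x_u) ^ k`. -/
def pfdSpan (𝔽 : Type*) [Field 𝔽] {n : ℕ} (i j : Fin n) :
    Submodule (coeffAlg 𝔽 i) (RatFun 𝔽 n) :=
  Submodule.span (coeffAlg 𝔽 i)
    ((Set.range fun a : ℤ => (x 𝔽 i / x 𝔽 j) ^ a) ∪
      {f | ∃ u, u ≠ i ∧ ∃ k : ℕ, 0 < k ∧ f = ((1 - x 𝔽 i / x 𝔽 u) ^ k)⁻¹})

theorem hasCT_of_mem_pfdSpan {𝔽 : Type*} [Field 𝔽] {n : ℕ} {i j : Fin n} (hij : j ≠ i)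
    {F : RatFun 𝔽 n} (hF : F ∈ pfdSpan 𝔽 i j) : ∃ c ∈ typeA 𝔽 n, HasCT i j F c := by
  induction hF using Submodule.span_induction with
  | mem y hy =>
    rcases hy with ⟨a, rfl⟩ | ⟨u, hu, k, hk, rfl⟩
    · refine ⟨0, (typeA 𝔽 n).zero_mem, hasCT_of_laurent i j ?_⟩
      have h1 : (x 𝔽 i / x 𝔽 j) ^ a =
          (⟨x 𝔽 j, x_mem_freeOf 𝔽 hij⟩ ^ (-a) : freeOf 𝔽 i) • x 𝔽 i ^ a := by
        have h2 : ((⟨x 𝔽 j, x_mem_freeOf 𝔽 hij⟩ ^ (-a) : freeOf 𝔽 i) : RatFun 𝔽 n) =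
            x 𝔽 j ^ (-a) := map_zpow₀ (freeOf 𝔽 i).val _ _
        rw [IntermediateField.smul_def, smul_eq_mul, h2, div_zpow, zpow_neg]
        ring
      beta_reduce
      rw [h1]
      exact Submodule.smul_mem _ _ (Submodule.subset_span ⟨a, rfl⟩)
    · refine ⟨_, ?_, hasCT_pole i j hu hk⟩
      split_ifs
      · exact (typeA 𝔽 n).one_mem
      · exact (typeA 𝔽 n).zero_mem
  | zero => exact ⟨0, (typeA 𝔽 n).zero_mem, hasCT_zero i j⟩
  | add y z _ _ hy hz =>
    obtain ⟨c, hc, h⟩ := hy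
    obtain ⟨c', hc', h'⟩ := hz
    refine ⟨c + c', (typeA 𝔽 n).add_mem hc hc', ?_⟩
    simpa using h.smul_add 1 h'
  | smul b y _ hy =>
    obtain ⟨c, hc, h⟩ := hy
    refine ⟨b * c, (typeA 𝔽 n).mul_mem b.2.1 hc, ?_⟩
    have := h.smul_add ⟨(b : RatFun 𝔽 n), b.2.2⟩ (hasCT_zero i j)
    simpa [Subalgebra.smul_def] using this

theorem pole_mem_pfdSpan {𝔽 : Type*} [Field 𝔽] {n : ℕ} {i : Fin n} (j : Fin n) {u : Fin n}
    (hu : u ≠ i) (k : ℕ) : (1 - x 𝔽 i / x 𝔽 u)⁻¹ ^ k ∈ pfdSpan 𝔽 i j := by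
  rcases Nat.eq_zero_or_pos k with rfl | hk
  · exact Submodule.subset_span (Or.inl ⟨0, by simp⟩)
  · exact Submodule.subset_span (Or.inr ⟨u, hu, k, hk, by rw [inv_pow]⟩)

theorem div_mem_coeffAlg (𝔽 : Type*) [Field 𝔽] {n : ℕ} {i u v : Fin n} (hu : u ≠ i)
    (hv : v ≠ i) : x 𝔽 u / x 𝔽 v ∈ coeffAlg 𝔽 i :=
  ⟨div_mem_typeA 𝔽 u v, (freeOf 𝔽 i).div_mem (x_mem_freeOf 𝔽 hu) (x_mem_freeOf 𝔽 hv)⟩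

theorem inv_mem_coeffAlg (𝔽 : Type*) [Field 𝔽] {n : ℕ} {i u v : Fin n} (hu : u ≠ i)
    (hv : v ≠ i) (h : u ≠ v) : (1 - x 𝔽 u / x 𝔽 v)⁻¹ ∈ coeffAlg 𝔽 i :=
  ⟨inv_mem_typeA 𝔽 h,
    (freeOf 𝔽 i).inv_mem ((freeOf 𝔽 i).sub_mem (freeOf 𝔽 i).one_mem
      ((freeOf 𝔽 i).div_mem (x_mem_freeOf 𝔽 hu) (x_mem_freeOf 𝔽 hv)))⟩

theorem zpow_mul_mem_pfdSpan {𝔽 : Type*} [Field 𝔽] {n : ℕ} {i j : Fin n} (hij : j ≠ i)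
    {u : Fin n} (hu : u ≠ i) (a : ℤ) (k : ℕ) :
    (x 𝔽 i / x 𝔽 j) ^ a * (1 - x 𝔽 i / x 𝔽 u)⁻¹ ^ k ∈ pfdSpan 𝔽 i j := by
  have hxi := x_ne_zero 𝔽 i
  have hxj := x_ne_zero 𝔽 j
  have hxu := x_ne_zero 𝔽 u
  have hz : x 𝔽 i / x 𝔽 j ≠ 0 := div_ne_zero hxi hxj
  have hd := one_sub_ne_zero 𝔽 hu.symm
  have hsmul : ∀ {b f : RatFun 𝔽 n}, b ∈ coeffAlg 𝔽 i → f ∈ pfdSpan 𝔽 i j →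
      b * f ∈ pfdSpan 𝔽 i j := fun {b f} hb hf =>
    (pfdSpan 𝔽 i j).smul_mem (⟨b, hb⟩ : coeffAlg 𝔽 i) hf
  induction k generalizing a with
  | zero => exact Submodule.subset_span (Or.inl ⟨a, by simp⟩)
  | succ k ih =>
    induction a using Int.induction_on with
    | zero => simpa using pole_mem_pfdSpan (𝔽 := 𝔽) j hu (k + 1)
    | succ m hm =>
      have e : (x 𝔽 i / x 𝔽 j) ^ ((m : ℤ) + 1) * (1 - x 𝔽 i / x 𝔽 u)⁻¹ ^ (k + 1) =
          x 𝔽 u / x 𝔽 j * ((x 𝔽 i / x 𝔽 j) ^ (m : ℤ) * (1 - x 𝔽 i / x 𝔽 u)⁻¹ ^ (k + 1)) -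
          x 𝔽 u / x 𝔽 j * ((x 𝔽 i / x 𝔽 j) ^ (m : ℤ) * (1 - x 𝔽 i / x 𝔽 u)⁻¹ ^ k) := by
        rw [zpow_add_one₀ hz, pow_succ]
        generalize (x 𝔽 i / x 𝔽 j) ^ (m : ℤ) = p
        have h1 : (1 - x 𝔽 i / x 𝔽 u)⁻¹ * (1 - x 𝔽 i / x 𝔽 u) = 1 := inv_mul_cancel₀ hd
        have h2 : x 𝔽 i / x 𝔽 j = x 𝔽 u / x 𝔽 j * (x 𝔽 i / x 𝔽 u) := by field_simp
        rw [h2]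
        linear_combination
          (-(p * (x 𝔽 u / x 𝔽 j) * (1 - x 𝔽 i / x 𝔽 u)⁻¹ ^ k)) * h1
      rw [e]
      exact Submodule.sub_mem _ (hsmul (div_mem_coeffAlg 𝔽 hu hij) hm)
        (hsmul (div_mem_coeffAlg 𝔽 hu hij) (ih _))
    | pred m hm =>
      have e : (x 𝔽 i / x 𝔽 j) ^ (-(m : ℤ) - 1) * (1 - x 𝔽 i / x 𝔽 u)⁻¹ ^ (k + 1) =
          (x 𝔽 i / x 𝔽 j) ^ (-(m : ℤ) - 1) * (1 - x 𝔽 i / x 𝔽 u)⁻¹ ^ k +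
          x 𝔽 j / x 𝔽 u * ((x 𝔽 i / x 𝔽 j) ^ (-(m : ℤ)) * (1 - x 𝔽 i / x 𝔽 u)⁻¹ ^ (k + 1)) := by
        have h3 : (x 𝔽 i / x 𝔽 j) ^ (-(m : ℤ)) =
            (x 𝔽 i / x 𝔽 j) ^ (-(m : ℤ) - 1) * (x 𝔽 i / x 𝔽 j) := by
          rw [← zpow_add_one₀ hz, sub_add_cancel]
        rw [h3, pow_succ]
        generalize (x 𝔽 i / x 𝔽 j) ^ (-(m : ℤ) - 1) = p
        have h1 : (1 - x 𝔽 i / x 𝔽 u)⁻¹ * (1 - x 𝔽 i / x 𝔽 u) = 1 := inv_mul_cancel₀ hd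
        have h2 : x 𝔽 j / x 𝔽 u * (x 𝔽 i / x 𝔽 j) = x 𝔽 i / x 𝔽 u := by field_simp
        linear_combination (p * (1 - x 𝔽 i / x 𝔽 u)⁻¹ ^ k) * h1 -
          (p * (1 - x 𝔽 i / x 𝔽 u)⁻¹ ^ k * (1 - x 𝔽 i / x 𝔽 u)⁻¹) * h2
      rw [e]
      exact Submodule.add_mem _ (ih _) (hsmul (div_mem_coeffAlg 𝔽 hij hu) hm)

theorem pole_mul_pole_mem_pfdSpan {𝔽 : Type*} [Field 𝔽] {n : ℕ} {i : Fin n} (j : Fin n)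
    {u v : Fin n} (hu : u ≠ i) (hv : v ≠ i) (k : ℕ) :
    (1 - x 𝔽 i / x 𝔽 u)⁻¹ * (1 - x 𝔽 i / x 𝔽 v)⁻¹ ^ k ∈ pfdSpan 𝔽 i j := by
  have hsmul : ∀ {b f : RatFun 𝔽 n}, b ∈ coeffAlg 𝔽 i → f ∈ pfdSpan 𝔽 i j →
      b * f ∈ pfdSpan 𝔽 i j := fun {b f} hb hf =>
    (pfdSpan 𝔽 i j).smul_mem (⟨b, hb⟩ : coeffAlg 𝔽 i) hf
  rcases eq_or_ne u v with rfl | huv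
  · rw [← pow_succ']
    exact pole_mem_pfdSpan j hu (k + 1)
  induction k with
  | zero => simpa using pole_mem_pfdSpan j hu 1
  | succ k ih =>
    have e : (1 - x 𝔽 i / x 𝔽 u)⁻¹ * (1 - x 𝔽 i / x 𝔽 v)⁻¹ ^ (k + 1) =
        (1 - x 𝔽 v / x 𝔽 u)⁻¹ * (1 - x 𝔽 i / x 𝔽 v)⁻¹ ^ (k + 1) +
        (1 - x 𝔽 u / x 𝔽 v)⁻¹ *
          ((1 - x 𝔽 i / x 𝔽 u)⁻¹ * (1 - x 𝔽 i / x 𝔽 v)⁻¹ ^ k) := by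
      have h1 : (1 - x 𝔽 i / x 𝔽 u)⁻¹ * (1 - x 𝔽 i / x 𝔽 v)⁻¹ =
          (1 - x 𝔽 v / x 𝔽 u)⁻¹ * (1 - x 𝔽 i / x 𝔽 v)⁻¹ +
            (1 - x 𝔽 u / x 𝔽 v)⁻¹ * (1 - x 𝔽 i / x 𝔽 u)⁻¹ := by
        have a1 := x_ne_zero 𝔽 u
        have a2 := x_ne_zero 𝔽 v
        have b : ∀ {p q : Fin n}, p ≠ q → x 𝔽 p - x 𝔽 q ≠ 0 := fun h =>
          sub_ne_zero.mpr fun e => h (x_injective 𝔽 e)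
        have b1 := b hu
        have b2 := b hv
        have b3 := b huv
        have b4 := b huv.symm
        simp only [one_sub_div a1, one_sub_div a2, inv_div]
        field_simp
        ring
      rw [pow_succ]
      linear_combination ((1 - x 𝔽 i / x 𝔽 v)⁻¹ ^ k) * h1
    rw [e]
    exact Submodule.add_mem _ (hsmul (inv_mem_coeffAlg 𝔽 hv hu huv.symm) (pole_mem_pfdSpan j hv _))
      (hsmul (inv_mem_coeffAlg 𝔽 hu hv huv) ih)

/-- The rational functions that multiply `pfdSpan` into itself. -/
def pfdStab (𝔽 : Type*) [Field 𝔽] {n : ℕ} (i j : Fin n) : Subalgebra 𝔽 (RatFun 𝔽 n) where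
  carrier := {f | ∀ g ∈ pfdSpan 𝔽 i j, f * g ∈ pfdSpan 𝔽 i j}
  mul_mem' := fun {a b} ha hb g hg => by
    rw [mul_assoc]
    exact ha _ (hb g hg)
  add_mem' := fun {a b} ha hb g hg => by
    rw [add_mul]
    exact Submodule.add_mem _ (ha g hg) (hb g hg)
  algebraMap_mem' := fun c g hg =>
    (pfdSpan 𝔽 i j).smul_mem (algebraMap 𝔽 (coeffAlg 𝔽 i) c) hg

theorem mem_pfdStab {𝔽 : Type*} [Field 𝔽] {n : ℕ} {i j : Fin n} {f : RatFun 𝔽 n}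
    (h1 : ∀ a : ℤ, f * (x 𝔽 i / x 𝔽 j) ^ a ∈ pfdSpan 𝔽 i j)
    (h2 : ∀ u, u ≠ i → ∀ k : ℕ, f * (1 - x 𝔽 i / x 𝔽 u)⁻¹ ^ k ∈ pfdSpan 𝔽 i j) :
    f ∈ pfdStab 𝔽 i j := by
  intro g hg
  induction hg using Submodule.span_induction with
  | mem y hy =>
    rcases hy with ⟨a, rfl⟩ | ⟨u, hu, k, hk, rfl⟩
    · exact h1 a
    · simpa using h2 u hu k
  | zero => simp
  | add y z _ _ hy hz =>
    rw [mul_add]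
    exact Submodule.add_mem _ hy hz
  | smul b y _ hy =>
    rw [mul_smul_comm]
    exact Submodule.smul_mem _ _ hy

theorem mem_pfdSpan_of_mem_typeA {𝔽 : Type*} [Field 𝔽] {n : ℕ} {i j : Fin n} (hij : j ≠ i)
    {F : RatFun 𝔽 n} (hF : F ∈ typeA 𝔽 n) : F ∈ pfdSpan 𝔽 i j := by
  have hone : (1 : RatFun 𝔽 n) ∈ pfdSpan 𝔽 i j := by
    simpa using pole_mem_pfdSpan (𝔽 := 𝔽) j hij 0
  have hcoeff : ∀ f ∈ coeffAlg 𝔽 i, f ∈ pfdStab 𝔽 i j := fun f hf g hg =>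
    (pfdSpan 𝔽 i j).smul_mem (⟨f, hf⟩ : coeffAlg 𝔽 i) hg
  have hz : ∀ a : ℤ, (x 𝔽 i / x 𝔽 j) ^ a ∈ pfdStab 𝔽 i j := fun a =>
    mem_pfdStab (fun b => by
      rw [← zpow_add₀ (div_ne_zero (x_ne_zero 𝔽 i) (x_ne_zero 𝔽 j))]
      exact Submodule.subset_span (Or.inl ⟨_, rfl⟩)) fun u hu k => zpow_mul_mem_pfdSpan hij hu a k
  have ht : ∀ u, u ≠ i → (1 - x 𝔽 i / x 𝔽 u)⁻¹ ∈ pfdStab 𝔽 i j := fun u hu =>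
    mem_pfdStab (fun a => by
      have := zpow_mul_mem_pfdSpan (𝔽 := 𝔽) hij hu a 1
      rwa [pow_one, mul_comm] at this) fun v hv k => pole_mul_pole_mem_pfdSpan j hu hv k
  have hinv : ∀ u v, u ≠ v → (1 - x 𝔽 u / x 𝔽 v)⁻¹ ∈ pfdStab 𝔽 i j := by
    intro u v huv
    rcases eq_or_ne u i with rfl | hu
    · exact ht v huv.symm
    rcases eq_or_ne v i with rfl | hv
    · have h2 : (1 - x 𝔽 u / x 𝔽 v)⁻¹ = 1 - (1 - x 𝔽 v / x 𝔽 u)⁻¹ := by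
        have a3 := x_ne_zero 𝔽 u
        have a4 := x_ne_zero 𝔽 v
        have a5 : x 𝔽 v - x 𝔽 u ≠ 0 := sub_ne_zero.mpr fun e => huv (x_injective 𝔽 e.symm)
        have a6 : x 𝔽 u - x 𝔽 v ≠ 0 := sub_ne_zero.mpr fun e => huv (x_injective 𝔽 e)
        rw [one_sub_div a4, one_sub_div a3, inv_div, inv_div]
        field_simp
        ring
      rw [h2]
      exact Subalgebra.sub_mem _ (Subalgebra.one_mem _) (ht u hu)
    · exact hcoeff _ (inv_mem_coeffAlg 𝔽 hu hv huv)
  obtain ⟨L, hL, q, rfl⟩ := hF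
  have hden : (denom 𝔽 q)⁻¹ ∈ pfdStab 𝔽 i j := by
    rw [denom, ← Finset.prod_inv_distrib]
    refine Subalgebra.prod_mem _ fun a _ => ?_
    rw [← Finset.prod_inv_distrib]
    refine Subalgebra.prod_mem _ fun b hb => ?_
    rw [← inv_pow]
    exact Subalgebra.pow_mem _ (hinv b a (Finset.mem_Ioi.mp hb).ne') _
  have hlau : L ∈ pfdStab 𝔽 i j := by
    have hle : laurentZero 𝔽 n ≤ Subalgebra.toSubmodule (pfdStab 𝔽 i j) := by
      refine Submodule.span_le.mpr ?_
      rintro _ ⟨a, ha, rfl⟩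
      have e : ∏ l, x 𝔽 l ^ a l = ∏ l, (x 𝔽 l / x 𝔽 j) ^ a l := by
        have hj : ∏ l, x 𝔽 j ^ a l = 1 := by
          have hs : ∀ s : Finset (Fin n), ∏ l ∈ s, x 𝔽 j ^ a l = x 𝔽 j ^ ∑ l ∈ s, a l := by
            intro s
            induction s using Finset.cons_induction with
            | empty => simp
            | cons b s hb ih =>
              rw [Finset.prod_cons, Finset.sum_cons, ih, zpow_add₀ (x_ne_zero 𝔽 j)]
          rw [hs, ha, zpow_zero]
        simp_rw [div_zpow]
        rw [Finset.prod_div_distrib, hj, div_one]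
      rw [e]
      change _ ∈ pfdStab 𝔽 i j
      refine Subalgebra.prod_mem _ fun l _ => ?_
      rcases eq_or_ne l i with rfl | hl
      · exact hz _
      · obtain ⟨m, hm | hm⟩ := Int.eq_nat_or_neg (a l)
        · rw [hm, zpow_natCast]
          exact hcoeff _ (Subalgebra.pow_mem _ (div_mem_coeffAlg 𝔽 hl hij) _)
        · rw [hm, zpow_neg, ← inv_zpow, inv_div, zpow_natCast]
          exact hcoeff _ (Subalgebra.pow_mem _ (div_mem_coeffAlg 𝔽 hij hl) _)
    exact hle hL
  have := (Subalgebra.mul_mem _ hlau hden) 1 hone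
  rwa [mul_one, ← div_eq_mul_inv] at this

/-- Every `F ∈ 𝒜_n` has a constant term at `x_i = x_j`, and it lies in `𝒜_n` again. -/
theorem exists_hasCT {𝔽 : Type*} [Field 𝔽] {n : ℕ} {i j : Fin n} (hij : j ≠ i)
    (F : typeA 𝔽 n) : ∃ c : typeA 𝔽 n, HasCT i j (F : RatFun 𝔽 n) c := by
  obtain ⟨c, hc, h⟩ := hasCT_of_mem_pfdSpan hij (mem_pfdSpan_of_mem_typeA hij F.2)
  exact ⟨⟨c, hc⟩, h⟩

/-- The commutator `[i,j]` for `i ≠ j`: the operator on `𝒜_n` that takes the constant term at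
`x_i = x_j`. (It is only used for `i ≠ j`; the value at `i = j` is set to `0`.) -/
def ct (𝔽 : Type*) [Field 𝔽] {n : ℕ} (i j : Fin n) : Module.End 𝔽 (typeA 𝔽 n) :=
  if h : j ≠ i then
    { toFun := fun F => (exists_hasCT h F).choose
      map_add' := fun F G => by
        have h1 := (exists_hasCT h F).choose_spec.smul_add 1 (exists_hasCT h G).choose_spec
        have h2 := (exists_hasCT h (F + G)).choose_spec
        apply Subtype.ext
        refine h2.unique h ?_
        simpa using h1
      map_smul' := fun c F => by
        have h1 := (exists_hasCT h F).choose_spec.smul_add (algebraMap 𝔽 (freeOf 𝔽 i) c)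
          (hasCT_zero i j)
        have h2 := (exists_hasCT h (c • F)).choose_spec
        apply Subtype.ext
        refine h2.unique h ?_
        have e : ((algebraMap 𝔽 (freeOf 𝔽 i) c : freeOf 𝔽 i) : RatFun 𝔽 n) =
          algebraMap 𝔽 (RatFun 𝔽 n) c := rfl
        rw [add_zero, add_zero, e, ← Algebra.smul_def, ← Algebra.smul_def] at h1
        exact h1 }
  else 0

theorem ct_spec (𝔽 : Type*) [Field 𝔽] {n : ℕ} {i j : Fin n} (hij : i ≠ j) (F : typeA 𝔽 n) :
    HasCT i j (F : RatFun 𝔽 n) (ct 𝔽 i j F : typeA 𝔽 n) := by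
  rw [ct, dif_pos hij.symm]
  exact (exists_hasCT hij.symm F).choose_spec

/-! ### The constant term algebra -/

/-- `Ξ`: the algebra of operators on `𝒜_n` generated by all commutators `[i,j]`. -/
def Xi (𝔽 : Type*) [Field 𝔽] (n : ℕ) : Subalgebra 𝔽 (Module.End 𝔽 (typeA 𝔽 n)) :=
  Algebra.adjoin 𝔽 {T | ∃ i j : Fin n, i ≠ j ∧ T = ct 𝔽 i j}

/-- The product `[i_s,j_s] ⋯ [i_1,j_1]` of the word `[(i_s,j_s), …, (i_1,j_1)]`; the right-most
commutator is applied first, and the empty word gives the identity. -/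
def wordOp (𝔽 : Type*) [Field 𝔽] {n : ℕ} (w : List (Fin n × Fin n)) :
    Module.End 𝔽 (typeA 𝔽 n) :=
  (w.map fun p => ct 𝔽 p.1 p.2).prod

/-- `T` is a monomial operator of degree `s`: a nonzero product of `s` commutators. -/
def IsMonomialOfDegree {𝔽 : Type*} [Field 𝔽] {n : ℕ} (s : ℕ)
    (T : Module.End 𝔽 (typeA 𝔽 n)) : Prop :=
  T ≠ 0 ∧ ∃ w : List (Fin n × Fin n), (∀ p ∈ w, p.1 ≠ p.2) ∧ w.length = s ∧ T = wordOp 𝔽 w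

/-- `Ξ^s`: the vector space spanned by all monomial operators of degree `s`. -/
def XiDeg (𝔽 : Type*) [Field 𝔽] (n s : ℕ) : Submodule 𝔽 (Module.End 𝔽 (typeA 𝔽 n)) :=
  Submodule.span 𝔽 {T | IsMonomialOfDegree s T}

/-! ### Ordered directed rooted forests -/

/-- An ordered digraph on the vertex set `{1, …, n}`: `children v` lists the vertices `u` with an
edge `u → v`, from left to right. -/
structure OrderedDigraph (n : ℕ) where
  children : Fin n → List (Fin n)

namespace OrderedDigraph

/-- There is an edge `i → j`. -/
def Edge {n : ℕ} (D : OrderedDigraph n) (i j : Fin n) : Prop := i ∈ D.children j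

/-- The vertex `r` is a root: no edge leaves it. -/
def IsRoot {n : ℕ} (D : OrderedDigraph n) (r : Fin n) : Prop := ∀ j, ¬ D.Edge r j

instance {n : ℕ} (D : OrderedDigraph n) : DecidablePred D.IsRoot := fun r =>
  inferInstanceAs (Decidable (∀ j, ¬ r ∈ D.children j))

/-- `D` is an ordered directed rooted forest: there are no multiple edges, at most one edge leaves
each vertex, and there is no directed cycle. (Isolated vertices are one-vertex trees.) -/
structure IsForest {n : ℕ} (D : OrderedDigraph n) : Prop where
  nodup : ∀ v, (D.children v).Nodup
  out_unique : ∀ i j k, D.Edge i j → D.Edge i k → j = k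
  acyclic : ∀ i, ¬ Relation.TransGen D.Edge i i

/-- The number of edges. A forest on `n` vertices has `s` edges if and only if it has `n - s`
connected components; with `n - 1` edges it is a tree. -/
def edgeCount {n : ℕ} (D : OrderedDigraph n) : ℕ := ∑ v, (D.children v).length

/-- Every edge `i → j` has `i > j`. -/
def Increasing {n : ℕ} (D : OrderedDigraph n) : Prop := ∀ i j, D.Edge i j → j < i

/-- Every edge `i → j` that does not end at a root has `i > j`. -/
def NearlyIncreasing {n : ℕ} (D : OrderedDigraph n) : Prop :=
  ∀ i j, D.Edge i j → ¬ D.IsRoot j → j < i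

/-- At each vertex, the children have increasing labels from left to right. -/
def Augmented {n : ℕ} (D : OrderedDigraph n) : Prop := ∀ v, (D.children v).Pairwise (· < ·)

/-- The vertices at distance `k` from `r`, from left to right. -/
def level {n : ℕ} (D : OrderedDigraph n) (r : Fin n) : ℕ → List (Fin n)
  | 0 => [r]
  | k + 1 => (D.level r k).flatMap D.children

/-- The edges of the tree with root `r`, read level by level starting at the root, and in each level
from left to right. -/
def treeWord {n : ℕ} (D : OrderedDigraph n) (r : Fin n) : List (Fin n × Fin n) :=
  (List.range n).flatMap fun k => (D.level r k).flatMap fun v => (D.children v).map fun u => (u, v)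

/-- The edges of a forest, read tree after tree. -/
def word {n : ℕ} (D : OrderedDigraph n) : List (Fin n × Fin n) :=
  ((List.finRange n).filter fun r => D.IsRoot r).flatMap D.treeWord

end OrderedDigraph

/-- The realization `L(D)` of an ordered directed rooted forest: the product of the commutators
`[i,j]` over the edges `i → j`, in the reading order. -/
def realization (𝔽 : Type*) [Field 𝔽] {n : ℕ} (D : OrderedDigraph n) :
    Module.End 𝔽 (typeA 𝔽 n) :=
  wordOp 𝔽 D.word

/-- `B^s`: the realizations of the augmented nearly increasing forests with `s` edges if
`s ≠ n - 1`, and of the augmented increasing trees on `{1, …, n}` if `s = n - 1`. -/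
def basisSet (𝔽 : Type*) [Field 𝔽] (n s : ℕ) : Set (Module.End 𝔽 (typeA 𝔽 n)) :=
  {T | ∃ D : OrderedDigraph n, D.IsForest ∧ D.edgeCount = s ∧ D.Augmented ∧
    (if s + 1 = n then D.Increasing else D.NearlyIncreasing) ∧ T = realization 𝔽 D}

end CTAlg

end

/-! Partial fractions in x_i over the functions of the other variables reduce [i,j] to linearity
over functions free of x_i and to its values on single terms: 1 on positive powers of 1/(1 -
x_i/x_j), 0 on Laurent monomials and on the other poles. Hence [i,j] eliminates x_i and vanishes on
functions in which x_i or x_j is absent (`ct_mem_and_eq_zero`). So a nonzero word eliminates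
distinct variables, never reuses an eliminated one, and has length less than n.

Evaluation on products of two terms gives the relations between two commutators: `ct_mul_comm`,
`ct_mul_ct`, `ct_mul_ct_chain`, `ct_mul_ct_eq_zero`. Together they exchange adjacent letters while
changing only second indices.

Spanning: the letter with the largest first index is moved to the right end of a word, and the rest
is treated recursively. This yields normal words (`wordOp_mem_span_isNormal`). The letters of a
normal word are the edges of an augmented nearly increasing forest, and its reading order differs
from the word only by interchanges of commuting letters (`wordOp_eq_of_perm`). A nonzero word of
length n - 1 leaves one variable; since [i,j] = -[j,i] on functions of x_i and x_j, this can be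
taken to be the first variable (`wordOp_mem_span_notMem`), and the forest is then an increasing
tree.

Directness: a vanishing sum of operators is grouped as a sum of T_S, where S is the set of
eliminated variables. Applying [a,b] kills T_S if S meets {a,b}; otherwise T_S commutes with
multiplication by functions g of x_a and x_b. Since G = 0 as soon as [a,b](gG) = 0 for all such g
(`eq_zero_of_ct_mul_eq_zero`), the T_S with S disjoint from {a,b} already sum to zero. Varying b and
inducting on S gives T_S = 0 whenever at least two indices lie outside S. Only degree n - 1 is left,
and it vanishes because the total sum does. -/

noncomputable section

namespace CTAlg

/-! ### Generators of `𝒜_n` and the subalgebras on fewer variables -/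

section Generators

variable (𝔽 : Type*) [Field 𝔽] {n : ℕ}

/-- `x_u / x_v`, as an element of `𝒜_n`. -/
def ratio (u v : Fin n) : typeA 𝔽 n := ⟨x 𝔽 u / x 𝔽 v, div_mem_typeA 𝔽 u v⟩

/-- `1 / (1 - x_u / x_v)`, as an element of `𝒜_n` (it is `0` for `u = v`). -/
def pole (u v : Fin n) : typeA 𝔽 n :=
  ⟨(1 - x 𝔽 u / x 𝔽 v)⁻¹, by
    rcases eq_or_ne u v with rfl | h
    · rw [div_self (x_ne_zero 𝔽 u), sub_self, inv_zero]
      exact (typeA 𝔽 n).zero_mem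
    · exact inv_mem_typeA 𝔽 h⟩

/-- The elements of `𝒜_n` that are built from the variables with index in `S` only. -/
def typeAOn (S : Finset (Fin n)) : Subalgebra 𝔽 (typeA 𝔽 n) :=
  Algebra.adjoin 𝔽 ({f | ∃ u ∈ S, ∃ v ∈ S, f = ratio 𝔽 u v} ∪
    {f | ∃ u ∈ S, ∃ v ∈ S, u ≠ v ∧ f = pole 𝔽 u v})

variable {S T : Finset (Fin n)} {i j u v w : Fin n}

@[simp] theorem coe_ratio (u v : Fin n) : (ratio 𝔽 u v : RatFun 𝔽 n) = x 𝔽 u / x 𝔽 v := rfl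

@[simp] theorem coe_pole (u v : Fin n) :
    (pole 𝔽 u v : RatFun 𝔽 n) = (1 - x 𝔽 u / x 𝔽 v)⁻¹ := rfl

theorem x_sub_ne_zero (h : u ≠ v) : x 𝔽 u - x 𝔽 v ≠ 0 :=
  sub_ne_zero.mpr fun e => h (x_injective 𝔽 e)

theorem coe_pole_eq (u v : Fin n) :
    (pole 𝔽 u v : RatFun 𝔽 n) = x 𝔽 v / (x 𝔽 v - x 𝔽 u) := by
  rw [coe_pole, one_sub_div (x_ne_zero 𝔽 v), inv_div]

theorem ratio_mul_ratio (u v w : Fin n) : ratio 𝔽 u v * ratio 𝔽 v w = ratio 𝔽 u w := by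
  have h := x_ne_zero 𝔽 v
  apply Subtype.ext
  simp only [MulMemClass.coe_mul, coe_ratio]
  field_simp

theorem ratio_self (u : Fin n) : ratio 𝔽 u u = 1 :=
  Subtype.ext (div_self (x_ne_zero 𝔽 u))

theorem ratio_mul_ratio_swap (u v : Fin n) : ratio 𝔽 u v * ratio 𝔽 v u = 1 := by
  rw [ratio_mul_ratio, ratio_self]

theorem pole_swap (h : u ≠ v) : pole 𝔽 v u = 1 - pole 𝔽 u v := by
  have h1 := x_sub_ne_zero 𝔽 h
  have h2 := x_sub_ne_zero 𝔽 h.symm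
  apply Subtype.ext
  rw [AddSubgroupClass.coe_sub, OneMemClass.coe_one, coe_pole_eq, coe_pole_eq]
  field_simp
  ring

/-- With `ratio_mul_pole` and `ratio_mul_pole'` (for b ≠ i) this is the multiplication table behind
partial fractions in x_i: a product of two factors in x_i becomes a sum of single terms with
coefficients free of x_i. -/
theorem pole_mul_pole (hu : u ≠ i) (hv : v ≠ i) (h : u ≠ v) :
    pole 𝔽 i u * pole 𝔽 i v =
      (1 - pole 𝔽 u v) * pole 𝔽 i v + pole 𝔽 u v * pole 𝔽 i u := by
  have h1 := x_sub_ne_zero 𝔽 hu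
  have h2 := x_sub_ne_zero 𝔽 hv
  have h3 := x_sub_ne_zero 𝔽 h.symm
  apply Subtype.ext
  simp only [MulMemClass.coe_mul, AddMemClass.coe_add, AddSubgroupClass.coe_sub,
    OneMemClass.coe_one, coe_pole_eq]
  field_simp
  ring

theorem ratio_mul_pole (b : Fin n) (h : u ≠ i) :
    ratio 𝔽 i b * pole 𝔽 i u = ratio 𝔽 u b * (pole 𝔽 i u - 1) := by
  have h1 := x_sub_ne_zero 𝔽 h
  have hb := x_ne_zero 𝔽 b
  apply Subtype.ext
  simp only [MulMemClass.coe_mul, AddSubgroupClass.coe_sub, OneMemClass.coe_one, coe_pole_eq,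
    coe_ratio]
  field_simp
  ring

theorem ratio_mul_pole' (b : Fin n) (h : u ≠ i) :
    ratio 𝔽 b i * pole 𝔽 i u = ratio 𝔽 b i + ratio 𝔽 b u * pole 𝔽 i u := by
  have h1 := x_sub_ne_zero 𝔽 h
  have hi := x_ne_zero 𝔽 i
  have hu := x_ne_zero 𝔽 u
  apply Subtype.ext
  simp only [MulMemClass.coe_mul, AddMemClass.coe_add, coe_pole_eq, coe_ratio]
  field_simp
  ring

variable {𝔽}

theorem ratio_mem (hu : u ∈ S) (hv : v ∈ S) : ratio 𝔽 u v ∈ typeAOn 𝔽 S :=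
  Algebra.subset_adjoin (Or.inl ⟨u, hu, v, hv, rfl⟩)

theorem pole_mem (hu : u ∈ S) (hv : v ∈ S) (h : u ≠ v) : pole 𝔽 u v ∈ typeAOn 𝔽 S :=
  Algebra.subset_adjoin (Or.inr ⟨u, hu, v, hv, h, rfl⟩)

theorem typeAOn_mono (h : S ⊆ T) : typeAOn 𝔽 S ≤ typeAOn 𝔽 T := by
  refine Algebra.adjoin_le ?_
  rintro _ (⟨u, hu, v, hv, rfl⟩ | ⟨u, hu, v, hv, huv, rfl⟩)
  · exact ratio_mem (h hu) (h hv)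
  · exact pole_mem (h hu) (h hv) huv

theorem typeAOn_subsingleton (h : S ⊆ {i}) : typeAOn 𝔽 S = ⊥ := by
  refine le_bot_iff.mp (Algebra.adjoin_le ?_)
  rintro _ (⟨u, hu, v, hv, rfl⟩ | ⟨u, hu, v, hv, huv, rfl⟩)
  · rw [Finset.mem_singleton.mp (h hu), Finset.mem_singleton.mp (h hv), ratio_self]
    exact Subalgebra.one_mem _
  · exact absurd ((Finset.mem_singleton.mp (h hu)).trans (Finset.mem_singleton.mp (h hv)).symm) huv

theorem typeAOn_univ : typeAOn 𝔽 (Finset.univ : Finset (Fin n)) = ⊤ := by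
  refine eq_top_iff.mpr fun F _ => ?_
  have key : ∀ f : RatFun 𝔽 n, f ∈ typeA 𝔽 n →
      f ∈ (typeAOn 𝔽 (Finset.univ : Finset (Fin n))).map (typeA 𝔽 n).val := by
    set B := (typeAOn 𝔽 (Finset.univ : Finset (Fin n))).map (typeA 𝔽 n).val
    have hr : ∀ u v : Fin n, x 𝔽 u / x 𝔽 v ∈ B := fun u v =>
      ⟨ratio 𝔽 u v, ratio_mem (Finset.mem_univ _) (Finset.mem_univ _), rfl⟩
    have hp : ∀ u v : Fin n, u ≠ v → (1 - x 𝔽 u / x 𝔽 v)⁻¹ ∈ B := fun u v h =>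
      ⟨pole 𝔽 u v, pole_mem (Finset.mem_univ _) (Finset.mem_univ _) h, rfl⟩
    rintro _ ⟨L, hL, q, rfl⟩
    rw [div_eq_mul_inv]
    refine B.mul_mem ?_ ?_
    · have hle : laurentZero 𝔽 n ≤ Subalgebra.toSubmodule B := by
        refine Submodule.span_le.mpr ?_
        rintro _ ⟨a, ha, rfl⟩
        rcases isEmpty_or_nonempty (Fin n) with hn | ⟨⟨b⟩⟩
        · simp
        have hs : ∀ s : Finset (Fin n), ∏ l ∈ s, x 𝔽 b ^ a l = x 𝔽 b ^ ∑ l ∈ s, a l := by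
          intro s
          induction s using Finset.cons_induction with
          | empty => simp
          | cons b s hb ih =>
            rw [Finset.prod_cons, Finset.sum_cons, ih, zpow_add₀ (x_ne_zero 𝔽 _)]
        -- The exponents sum to zero, so every variable may be divided by x_b.
        have e : ∏ l, x 𝔽 l ^ a l = ∏ l, (x 𝔽 l / x 𝔽 b) ^ a l := by
          simp_rw [div_zpow]
          rw [Finset.prod_div_distrib, hs, ha, zpow_zero, div_one]
        rw [e]
        change _ ∈ B
        refine Subalgebra.prod_mem _ fun l _ => ?_
        obtain ⟨m, hm | hm⟩ := Int.eq_nat_or_neg (a l)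
        · rw [hm, zpow_natCast]
          exact Subalgebra.pow_mem _ (hr _ _) _
        · rw [hm, zpow_neg, ← inv_zpow, inv_div, zpow_natCast]
          exact Subalgebra.pow_mem _ (hr _ _) _
      exact hle hL
    · rw [denom, ← Finset.prod_inv_distrib]
      refine Subalgebra.prod_mem _ fun a _ => ?_
      rw [← Finset.prod_inv_distrib]
      refine Subalgebra.prod_mem _ fun b hb => ?_
      rw [← inv_pow]
      exact Subalgebra.pow_mem _ (hp b a (Finset.mem_Ioi.mp hb).ne') _
  obtain ⟨G, hG, h⟩ := key F F.2
  rwa [← Subtype.ext h]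

theorem mem_typeAOn_univ (F : typeA 𝔽 n) : F ∈ typeAOn 𝔽 (Finset.univ : Finset (Fin n)) := by
  rw [typeAOn_univ]
  exact Algebra.mem_top

/-! ### Partial fractions in one variable, over the functions of the other variables -/

/-- The terms in `x_i` of a partial fraction decomposition with poles at the `x_u`, `u ∈ S`. -/
def IsPFTerm (i b : Fin n) (S : Finset (Fin n)) (P : typeA 𝔽 n) : Prop :=
  (∃ a : ℕ, P = ratio 𝔽 i b ^ a) ∨ (∃ a : ℕ, P = ratio 𝔽 b i ^ a) ∨
    ∃ u ∈ S, ∃ m : ℕ, P = pole 𝔽 i u ^ (m + 1)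

variable (𝔽) in
/-- The combinations of partial fraction terms in `x_i` with coefficients in `typeAOn 𝔽 S`. -/
def pfSpan (i b : Fin n) (S : Finset (Fin n)) : Submodule 𝔽 (typeA 𝔽 n) :=
  Submodule.span 𝔽 {F | ∃ c ∈ typeAOn 𝔽 S, ∃ P, IsPFTerm i b S P ∧ F = c * P}

theorem mul_mem_pfSpan {b : Fin n} {c F : typeA 𝔽 n} (hc : c ∈ typeAOn 𝔽 S)
    (hF : F ∈ pfSpan 𝔽 i b S) : c * F ∈ pfSpan 𝔽 i b S := by
  induction hF using Submodule.span_induction with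
  | mem F hF =>
    obtain ⟨d, hd, P, hP, rfl⟩ := hF
    exact Submodule.subset_span ⟨c * d, Subalgebra.mul_mem _ hc hd, P, hP, by rw [mul_assoc]⟩
  | zero => simp
  | add F G _ _ hF hG => rw [mul_add]; exact Submodule.add_mem _ hF hG
  | smul a F _ hF => rw [mul_smul_comm]; exact Submodule.smul_mem _ _ hF

theorem IsPFTerm.mem_pfSpan {b : Fin n} {P : typeA 𝔽 n} (h : IsPFTerm i b S P) :
    P ∈ pfSpan 𝔽 i b S :=
  Submodule.subset_span ⟨1, Subalgebra.one_mem _, P, h, by rw [one_mul]⟩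

/-- The elements that multiply `pfSpan` into itself. -/
def pfStab (𝔽 : Type*) [Field 𝔽] {n : ℕ} (i b : Fin n) (S : Finset (Fin n)) :
    Subalgebra 𝔽 (typeA 𝔽 n) where
  carrier := {f | ∀ g ∈ pfSpan 𝔽 i b S, f * g ∈ pfSpan 𝔽 i b S}
  mul_mem' := fun {a b} ha hb g hg => by
    rw [mul_assoc]
    exact ha _ (hb g hg)
  add_mem' := fun {a b} ha hb g hg => by
    rw [add_mul]
    exact Submodule.add_mem _ (ha g hg) (hb g hg)
  algebraMap_mem' := fun c g hg => by
    rw [← Algebra.smul_def]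
    exact Submodule.smul_mem _ _ hg

theorem mem_pfStab {b : Fin n} {f : typeA 𝔽 n}
    (h : ∀ P, IsPFTerm i b S P → f * P ∈ pfSpan 𝔽 i b S) : f ∈ pfStab 𝔽 i b S := by
  intro g hg
  induction hg using Submodule.span_induction with
  | mem F hF =>
    obtain ⟨d, hd, P, hP, rfl⟩ := hF
    rw [mul_left_comm]
    exact mul_mem_pfSpan hd (h P hP)
  | zero => simp
  | add F G _ _ hF hG => rw [mul_add]; exact Submodule.add_mem _ hF hG
  | smul a F _ hF => rw [mul_smul_comm]; exact Submodule.smul_mem _ _ hF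

theorem pole_pow_mem_pfSpan {b : Fin n} (hu : u ∈ S) (m : ℕ) :
    pole 𝔽 i u ^ m ∈ pfSpan 𝔽 i b S := by
  rcases m with _ | m
  · exact IsPFTerm.mem_pfSpan (Or.inl ⟨0, by simp⟩)
  · exact IsPFTerm.mem_pfSpan (Or.inr (Or.inr ⟨u, hu, m, rfl⟩))

theorem ratio_mem_pfStab {b : Fin n} (hi : i ∉ S) (hb : b ∈ S) :
    ratio 𝔽 i b ∈ pfStab 𝔽 i b S := by
  refine mem_pfStab ?_
  rintro _ (⟨a, rfl⟩ | ⟨a, rfl⟩ | ⟨u, hu, m, rfl⟩)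
  · rw [← pow_succ']
    exact IsPFTerm.mem_pfSpan (Or.inl ⟨_, rfl⟩)
  · rcases a with _ | a
    · rw [pow_zero, ← pow_zero (ratio 𝔽 i b), ← pow_succ']
      exact IsPFTerm.mem_pfSpan (Or.inl ⟨_, rfl⟩)
    · rw [pow_succ', ← mul_assoc, ratio_mul_ratio_swap, one_mul]
      exact IsPFTerm.mem_pfSpan (Or.inr (Or.inl ⟨_, rfl⟩))
  · rw [pow_succ', ← mul_assoc, ratio_mul_pole 𝔽 b (ne_of_mem_of_not_mem hu hi), mul_assoc,
      sub_mul, one_mul, ← pow_succ']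
    exact mul_mem_pfSpan (ratio_mem hu hb)
      (Submodule.sub_mem _ (pole_pow_mem_pfSpan hu _) (pole_pow_mem_pfSpan hu _))

theorem ratio_swap_mem_pfStab {b : Fin n} (hi : i ∉ S) (hb : b ∈ S) :
    ratio 𝔽 b i ∈ pfStab 𝔽 i b S := by
  have h0 : ∀ a, ratio 𝔽 b i * ratio 𝔽 b i ^ a ∈ pfSpan 𝔽 i b S := fun a => by
    rw [← pow_succ']
    exact IsPFTerm.mem_pfSpan (Or.inr (Or.inl ⟨_, rfl⟩))
  refine mem_pfStab ?_
  rintro _ (⟨a, rfl⟩ | ⟨a, rfl⟩ | ⟨u, hu, m, rfl⟩)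
  · rcases a with _ | a
    · simpa using h0 0
    · rw [pow_succ', ← mul_assoc, ratio_mul_ratio_swap, one_mul]
      exact IsPFTerm.mem_pfSpan (Or.inl ⟨_, rfl⟩)
  · exact h0 a
  -- `ratio_mul_pole'` drops one pole factor in its first summand and the factor x_b/x_i in its
  -- second, hence induction on m.
  · have h1 : ∀ m, ratio 𝔽 b i * pole 𝔽 i u ^ m ∈ pfSpan 𝔽 i b S := by
      intro m
      induction m with
      | zero => simpa using h0 0
      | succ m ih =>
        have e : ratio 𝔽 b i * pole 𝔽 i u ^ (m + 1) =
            ratio 𝔽 b i * pole 𝔽 i u ^ m + ratio 𝔽 b u * pole 𝔽 i u ^ (m + 1) := by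
          have := ratio_mul_pole' 𝔽 b (ne_of_mem_of_not_mem hu hi)
          rw [pow_succ]
          linear_combination pole 𝔽 i u ^ m * this
        rw [e]
        exact Submodule.add_mem _ ih
          (mul_mem_pfSpan (ratio_mem hb hu) (pole_pow_mem_pfSpan hu _))
    exact h1 _

theorem pole_mem_pfStab {b : Fin n} (hi : i ∉ S) (hb : b ∈ S) (hu : u ∈ S) :
    pole 𝔽 i u ∈ pfStab 𝔽 i b S := by
  have hui := ne_of_mem_of_not_mem hu hi
  have h1 : pole 𝔽 i u ∈ pfSpan 𝔽 i b S := by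
    simpa using pole_pow_mem_pfSpan (𝔽 := 𝔽) (b := b) (i := i) hu 1
  refine mem_pfStab ?_
  rintro _ (⟨a, rfl⟩ | ⟨a, rfl⟩ | ⟨v, hv, m, rfl⟩)
  · rw [mul_comm]
    exact Subalgebra.pow_mem _ (ratio_mem_pfStab hi hb) a _ h1
  · rw [mul_comm]
    exact Subalgebra.pow_mem _ (ratio_swap_mem_pfStab hi hb) a _ h1
  · have hvi := ne_of_mem_of_not_mem hv hi
    rcases eq_or_ne u v with rfl | huv
    · rw [← pow_succ']
      exact pole_pow_mem_pfSpan hu _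
    -- One use of `pole_mul_pole` leaves a pure power of the pole at x_v and the same product with a
    -- smaller exponent.
    · have h2 : ∀ m, pole 𝔽 i u * pole 𝔽 i v ^ m ∈ pfSpan 𝔽 i b S := by
        intro m
        induction m with
        | zero => simpa using h1
        | succ m ih =>
          have e : pole 𝔽 i u * pole 𝔽 i v ^ (m + 1) =
              (1 - pole 𝔽 u v) * pole 𝔽 i v ^ (m + 1) +
                pole 𝔽 u v * (pole 𝔽 i u * pole 𝔽 i v ^ m) := by
            have := pole_mul_pole 𝔽 hui hvi huv
            rw [pow_succ]
            linear_combination pole 𝔽 i v ^ m * this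
          rw [e]
          have hm := pole_mem (𝔽 := 𝔽) hu hv huv
          exact Submodule.add_mem _
            (mul_mem_pfSpan (Subalgebra.sub_mem _ (Subalgebra.one_mem _) hm)
              (pole_pow_mem_pfSpan hv _))
            (mul_mem_pfSpan hm ih)
      exact h2 _

/-- Partial fraction decomposition in `x_i` over the functions of the variables in `S`. -/
theorem mem_pfSpan_of_mem_insert {b : Fin n} (hi : i ∉ S) (hb : b ∈ S) {F : typeA 𝔽 n}
    (hF : F ∈ typeAOn 𝔽 (insert i S)) : F ∈ pfSpan 𝔽 i b S := by
  have hS : typeAOn 𝔽 S ≤ pfStab 𝔽 i b S := fun c hc g hg => mul_mem_pfSpan hc hg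
  -- As `pfSpan` contains 1, it is enough that each generator multiplies it into itself.
  have hle : typeAOn 𝔽 (insert i S) ≤ pfStab 𝔽 i b S := by
    refine Algebra.adjoin_le ?_
    rintro _ (⟨u, hu, v, hv, rfl⟩ | ⟨u, hu, v, hv, huv, rfl⟩)
    -- All ratios are factored through the base variable x_b, the only one against which x_i is
    -- measured in `pfSpan`.
    · have h1 : ∀ u ∈ insert i S, ratio 𝔽 u b ∈ pfStab 𝔽 i b S := by
        intro u hu
        rcases Finset.mem_insert.mp hu with rfl | hu
        · exact ratio_mem_pfStab hi hb
        · exact hS (ratio_mem hu hb)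
      have h2 : ∀ u ∈ insert i S, ratio 𝔽 b u ∈ pfStab 𝔽 i b S := by
        intro u hu
        rcases Finset.mem_insert.mp hu with rfl | hu
        · exact ratio_swap_mem_pfStab hi hb
        · exact hS (ratio_mem hb hu)
      rw [← ratio_mul_ratio 𝔽 u b v]
      exact Subalgebra.mul_mem _ (h1 u hu) (h2 v hv)
    · rcases Finset.mem_insert.mp hu with rfl | hu
      · exact pole_mem_pfStab hi hb (Finset.mem_of_mem_insert_of_ne hv huv.symm)
      · rcases Finset.mem_insert.mp hv with rfl | hv
        · rw [pole_swap 𝔽 huv.symm]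
          exact Subalgebra.sub_mem _ (Subalgebra.one_mem _)
            (pole_mem_pfStab hi hb (Finset.mem_of_mem_insert_of_ne hu huv))
        · exact hS (pole_mem hu hv huv)
  have h1 : (1 : typeA 𝔽 n) ∈ pfSpan 𝔽 i b S := IsPFTerm.mem_pfSpan (Or.inl ⟨0, by simp⟩)
  simpa using hle hF 1 h1

/-! ### Values of the commutators -/

theorem coe_mem_freeOf (hi : i ∉ S) {F : typeA 𝔽 n} (hF : F ∈ typeAOn 𝔽 S) :
    (F : RatFun 𝔽 n) ∈ freeOf 𝔽 i := by
  have hle : typeAOn 𝔽 S ≤ (freeOf 𝔽 i).toSubalgebra.comap (typeA 𝔽 n).val := by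
    refine Algebra.adjoin_le ?_
    have hx : ∀ u ∈ S, x 𝔽 u ∈ freeOf 𝔽 i := fun u hu =>
      x_mem_freeOf 𝔽 (ne_of_mem_of_not_mem hu hi)
    rintro _ (⟨u, hu, v, hv, rfl⟩ | ⟨u, hu, v, hv, huv, rfl⟩)
    · exact (freeOf 𝔽 i).div_mem (hx u hu) (hx v hv)
    · exact (freeOf 𝔽 i).inv_mem ((freeOf 𝔽 i).sub_mem (freeOf 𝔽 i).one_mem
        ((freeOf 𝔽 i).div_mem (hx u hu) (hx v hv)))
  exact hle hF

theorem ct_eq (hij : i ≠ j) {F c : typeA 𝔽 n} (h : HasCT i j (F : RatFun 𝔽 n) c) :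
    ct 𝔽 i j F = c :=
  Subtype.ext ((ct_spec 𝔽 hij F).unique hij.symm h)

theorem ct_self (i : Fin n) : ct 𝔽 i i = 0 := by
  rw [ct, dif_neg (by simp)]

/-- A factor free of x_i scales the whole partial fraction decomposition. The case i = j is harmless
because `ct` is 0 there. -/
theorem ct_mul (hi : i ∉ S) {c : typeA 𝔽 n} (hc : c ∈ typeAOn 𝔽 S) (F : typeA 𝔽 n) :
    ct 𝔽 i j (c * F) = c * ct 𝔽 i j F := by
  rcases eq_or_ne i j with rfl | hij
  · simp [ct_self]
  · refine ct_eq hij ?_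
    have := (ct_spec 𝔽 hij F).smul_add ⟨c, coe_mem_freeOf hi hc⟩ (hasCT_zero i j)
    simpa using this

theorem ct_mul' (hi : i ∉ S) {c : typeA 𝔽 n} (hc : c ∈ typeAOn 𝔽 S) (F : typeA 𝔽 n) :
    ct 𝔽 i j (F * c) = ct 𝔽 i j F * c := by
  rw [mul_comm, ct_mul hi hc, mul_comm]

theorem ct_ratio_pow (b : Fin n) (a : ℕ) : ct 𝔽 i j (ratio 𝔽 i b ^ a) = 0 := by
  rcases eq_or_ne i j with rfl | hij
  · simp [ct_self]
  rcases eq_or_ne i b with rfl | hb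
  · rw [ratio_self, one_pow]
    refine ct_eq hij (hasCT_of_laurent i j (Submodule.subset_span ⟨0, by simp⟩))
  refine ct_eq hij (hasCT_of_laurent i j ?_)
  have e : ((ratio 𝔽 i b ^ a : typeA 𝔽 n) : RatFun 𝔽 n) =
      (⟨x 𝔽 b, x_mem_freeOf 𝔽 hb.symm⟩⁻¹ ^ a : freeOf 𝔽 i) • x 𝔽 i ^ (a : ℤ) := by
    rw [IntermediateField.smul_def]
    simp [div_eq_inv_mul, mul_pow]
  rw [e]
  exact Submodule.smul_mem _ _ (Submodule.subset_span ⟨a, rfl⟩)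

theorem ct_ratio_swap_pow (b : Fin n) (a : ℕ) : ct 𝔽 i j (ratio 𝔽 b i ^ a) = 0 := by
  rcases eq_or_ne i j with rfl | hij
  · simp [ct_self]
  rcases eq_or_ne i b with rfl | hb
  · exact ct_ratio_pow i a
  refine ct_eq hij (hasCT_of_laurent i j ?_)
  have e : ((ratio 𝔽 b i ^ a : typeA 𝔽 n) : RatFun 𝔽 n) =
      (⟨x 𝔽 b, x_mem_freeOf 𝔽 hb.symm⟩ ^ a : freeOf 𝔽 i) • x 𝔽 i ^ (-a : ℤ) := by
    rw [IntermediateField.smul_def]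
    simp [div_eq_mul_inv, mul_pow]
  rw [e]
  exact Submodule.smul_mem _ _ (Submodule.subset_span ⟨-a, rfl⟩)

theorem ct_one : ct 𝔽 i j (1 : typeA 𝔽 n) = 0 := by
  simpa using ct_ratio_pow (𝔽 := 𝔽) (i := i) (j := j) i 0

theorem ct_pole_pow (hu : u ≠ i) (hij : i ≠ j) (m : ℕ) :
    ct 𝔽 i j (pole 𝔽 i u ^ (m + 1)) = if u = j then 1 else 0 := by
  refine ct_eq hij ?_
  have := hasCT_pole (𝔽 := 𝔽) i j hu (Nat.succ_pos m)
  rw [SubmonoidClass.coe_pow, coe_pole, inv_pow]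
  split_ifs with h <;> simpa [h] using this

theorem ct_typeAOn_of_notMem_left (hi : i ∉ S) {F : typeA 𝔽 n} (hF : F ∈ typeAOn 𝔽 S) :
    ct 𝔽 i j F = 0 := by
  have := ct_mul (j := j) hi hF 1
  rwa [mul_one, ct_one, mul_zero] at this

/-- The value on a term is a scalar, and scalars pass through every further commutator;
`IsPFTerm.ct_ct_mul` relies on this. -/
theorem IsPFTerm.exists_ct_eq {b : Fin n} {P : typeA 𝔽 n} (h : IsPFTerm i b S P)
    (hi : i ∉ S) (j : Fin n) :
    ∃ c : 𝔽, ct 𝔽 i j P = algebraMap 𝔽 _ c ∧ (j ∉ S → c = 0) := by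
  rcases eq_or_ne i j with rfl | hij
  · exact ⟨0, by simp [ct_self], fun _ => rfl⟩
  rcases h with ⟨a, rfl⟩ | ⟨a, rfl⟩ | ⟨u, hu, m, rfl⟩
  · exact ⟨0, by simp [ct_ratio_pow], fun _ => rfl⟩
  · exact ⟨0, by simp [ct_ratio_swap_pow], fun _ => rfl⟩
  · refine ⟨if u = j then 1 else 0, ?_, fun hj => if_neg (ne_of_mem_of_not_mem hu hj)⟩
    rw [ct_pole_pow (ne_of_mem_of_not_mem hu hi) hij]
    split_ifs <;> simp

/-- The source of all vanishing statements about words. If some b in S differs from i, F is expanded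
in x_i with base variable x_b; if not, degree 0 forces F to be constant. -/
theorem ct_mem_and_eq_zero {F : typeA 𝔽 n} (hF : F ∈ typeAOn 𝔽 S) (i j : Fin n) :
    ct 𝔽 i j F ∈ typeAOn 𝔽 (S.erase i) ∧ (j ∉ S → ct 𝔽 i j F = 0) := by
  by_cases hi : i ∈ S
  · rcases (S.erase i).eq_empty_or_nonempty with h0 | ⟨b, hb⟩
    · have hS : S ⊆ {i} := by
        intro a ha
        by_contra h
        exact Finset.notMem_empty a (h0 ▸ Finset.mem_erase.mpr ⟨by simpa using h, ha⟩)
      rw [typeAOn_subsingleton hS] at hF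
      obtain ⟨c, rfl⟩ := Algebra.mem_bot.mp hF
      have : ct 𝔽 i j (algebraMap 𝔽 (typeA 𝔽 n) c) = 0 := by
        rw [Algebra.algebraMap_eq_smul_one, map_smul, ct_one, smul_zero]
      rw [this]
      exact ⟨Subalgebra.zero_mem _, fun _ => rfl⟩
    · have hi' := Finset.notMem_erase i S
      rw [← Finset.insert_erase hi] at hF
      have hF' := mem_pfSpan_of_mem_insert hi' hb hF
      have key : ∀ G ∈ pfSpan 𝔽 i b (S.erase i), ct 𝔽 i j G ∈ typeAOn 𝔽 (S.erase i) ∧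
          (j ∉ S → ct 𝔽 i j G = 0) := by
        intro G hG
        induction hG using Submodule.span_induction with
        | mem F hF =>
          obtain ⟨d, hd, P, hP, rfl⟩ := hF
          obtain ⟨c, hc, hc0⟩ := hP.exists_ct_eq hi' j
          rw [ct_mul hi' hd, hc]
          refine ⟨Subalgebra.mul_mem _ hd (Subalgebra.algebraMap_mem _ _), fun hj => ?_⟩
          rw [hc0 fun h => hj (Finset.mem_of_mem_erase h), map_zero, mul_zero]
        | zero => simp
        | add F G _ _ hF hG =>
          rw [map_add]
          exact ⟨Subalgebra.add_mem _ hF.1 hG.1, fun h => by rw [hF.2 h, hG.2 h, add_zero]⟩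
        | smul a F _ hF =>
          rw [map_smul]
          exact ⟨Subalgebra.smul_mem _ hF.1 a, fun h => by rw [hF.2 h, smul_zero]⟩
      exact key F hF'
  · rw [ct_typeAOn_of_notMem_left hi hF]
    exact ⟨Subalgebra.zero_mem _, fun _ => rfl⟩

theorem ct_mem_erase {F : typeA 𝔽 n} (hF : F ∈ typeAOn 𝔽 S) (i j : Fin n) :
    ct 𝔽 i j F ∈ typeAOn 𝔽 (S.erase i) :=
  (ct_mem_and_eq_zero hF i j).1

theorem ct_typeAOn_of_notMem_right (hj : j ∉ S) {F : typeA 𝔽 n} (hF : F ∈ typeAOn 𝔽 S)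
    (i : Fin n) : ct 𝔽 i j F = 0 :=
  (ct_mem_and_eq_zero hF i j).2 hj

end Generators

/-! ### Relations between commutators -/

section Relations

variable {𝔽 : Type*} [Field 𝔽] {n : ℕ} {S : Finset (Fin n)} {i j k l : Fin n}

/-- The functional p ↦ p(1) - p(0) sends 1 to 0 and every positive power of X to 1. Applied to (1 -
X)^(m+1) it evaluates the reversed pole, which equals 1 minus the pole. -/
theorem ct_aeval_pole (hij : i ≠ j) (p : 𝔽[X]) :
    ct 𝔽 i j (Polynomial.aeval (pole 𝔽 i j) p) = algebraMap 𝔽 _ (p.eval 1 - p.eval 0) := by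
  induction p using Polynomial.induction_on' with
  | add p q hp hq =>
    rw [map_add, map_add, hp, hq, ← map_add, Polynomial.eval_add, Polynomial.eval_add]
    congr 1
    ring
  | monomial m a =>
    rw [Polynomial.aeval_monomial, ← Algebra.smul_def, map_smul]
    rcases m with _ | m
    · simp [ct_one]
    · rw [ct_pole_pow hij.symm hij, if_pos rfl]
      simp [Algebra.smul_def]

theorem ct_pole_swap_pow (hij : i ≠ j) (m : ℕ) : ct 𝔽 i j (pole 𝔽 j i ^ (m + 1)) = -1 := by
  have := ct_aeval_pole (𝔽 := 𝔽) hij ((1 - Polynomial.X) ^ (m + 1))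
  rw [pole_swap 𝔽 hij]
  simpa using this

/-- On functions of `x_i` and `x_j` only, `[i,j] = -[j,i]`. -/
theorem ct_eq_neg_ct_swap (hij : i ≠ j) {F : typeA 𝔽 n} (hF : F ∈ typeAOn 𝔽 {i, j}) :
    ct 𝔽 i j F = -ct 𝔽 j i F := by
  have hi : i ∉ ({j} : Finset (Fin n)) := by simpa using hij
  have hF' := mem_pfSpan_of_mem_insert hi (Finset.mem_singleton_self j) hF
  clear hF
  induction hF' using Submodule.span_induction with
  | mem F hF =>
    obtain ⟨c, hc, P, hP, rfl⟩ := hF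
    -- The coefficient is a function of x_j alone, hence a scalar, and so passes through both [i,j]
    -- and [j,i].
    rw [typeAOn_subsingleton (i := j) subset_rfl] at hc
    obtain ⟨c, rfl⟩ := Algebra.mem_bot.mp hc
    rw [← Algebra.smul_def, map_smul, map_smul, ← smul_neg]
    congr 1
    rcases hP with ⟨a, rfl⟩ | ⟨a, rfl⟩ | ⟨u, hu, m, rfl⟩
    · rw [ct_ratio_pow, ct_ratio_swap_pow, neg_zero]
    · rw [ct_ratio_pow, ct_ratio_swap_pow, neg_zero]
    · rw [Finset.mem_singleton.mp hu, ct_pole_swap_pow hij.symm, ct_pole_pow hij.symm hij,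
        if_pos rfl, neg_neg]
  | zero => simp
  | add F G _ _ hF hG => rw [map_add, map_add, hF, hG]; abel
  | smul a F _ hF => rw [map_smul, map_smul, hF, smul_neg]

/-- Extensionality on products of partial fraction terms in two variables. -/
theorem end_eq_zero_of_pfTerm {b : Fin n} (hik : i ≠ k) (hi : i ∉ S) (hk : k ∉ S) (hb : b ∈ S)
    (hS : insert i (insert k S) = Finset.univ) (Φ : Module.End 𝔽 (typeA 𝔽 n))
    (hlin : ∀ c ∈ typeAOn 𝔽 S, ∀ F, Φ (c * F) = c * Φ F)
    (hΦ : ∀ P Q, IsPFTerm i b (insert k S) P → IsPFTerm k b S Q → Φ (P * Q) = 0) : Φ = 0 := by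
  have hi' : i ∉ insert k S := by simp [hik, hi]
  refine LinearMap.ext fun F => ?_
  have hF := mem_typeAOn_univ F
  rw [← hS] at hF
  have hF' := mem_pfSpan_of_mem_insert hi' (Finset.mem_insert_of_mem hb) hF
  clear hF
  change Φ F = 0
  induction hF' using Submodule.span_induction with
  | mem F hF =>
    obtain ⟨c, hc, P, hP, rfl⟩ := hF
    -- The coefficient of P may still involve x_k, so it is expanded in turn.
    have hc' := mem_pfSpan_of_mem_insert hk hb hc
    clear hc
    induction hc' using Submodule.span_induction with
    | mem c hc =>
      obtain ⟨d, hd, Q, hQ, rfl⟩ := hc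
      rw [mul_assoc, hlin d hd, mul_comm Q, hΦ P Q hP hQ, mul_zero]
    | zero => simp
    | add c d _ _ hc hd => rw [add_mul, map_add, hc, hd, add_zero]
    | smul a c _ hc => rw [smul_mul_assoc, map_smul, hc, smul_zero]
  | zero => simp
  | add F G _ _ hF hG => rw [map_add, hF, hG, add_zero]
  | smul a F _ hF => rw [map_smul, hF, smul_zero]

/-- A partial fraction term in `x_i` is either a power of `1 / (1 - x_i / x_k)` or free of `x_k`. -/
theorem IsPFTerm.of_insert {b : Fin n} {P : typeA 𝔽 n} (h : IsPFTerm i b (insert k S) P) :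
    IsPFTerm i b S P ∨ ∃ m : ℕ, P = pole 𝔽 i k ^ (m + 1) := by
  rcases h with ⟨a, rfl⟩ | ⟨a, rfl⟩ | ⟨u, hu, m, rfl⟩
  · exact Or.inl (Or.inl ⟨a, rfl⟩)
  · exact Or.inl (Or.inr (Or.inl ⟨a, rfl⟩))
  · rcases Finset.mem_insert.mp hu with rfl | hu
    · exact Or.inr ⟨m, rfl⟩
    · exact Or.inl (Or.inr (Or.inr ⟨u, hu, m, rfl⟩))

theorem IsPFTerm.mem_typeAOn {b : Fin n} {P : typeA 𝔽 n} (hi : i ∉ S) (hb : b ∈ S)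
    (h : IsPFTerm i b S P) : P ∈ typeAOn 𝔽 (insert i S) := by
  have hi' := Finset.mem_insert_self i S
  have hs : ∀ {u}, u ∈ S → u ∈ insert i S := fun h => Finset.mem_insert_of_mem h
  rcases h with ⟨a, rfl⟩ | ⟨a, rfl⟩ | ⟨u, hu, m, rfl⟩
  · exact Subalgebra.pow_mem _ (ratio_mem hi' (hs hb)) _
  · exact Subalgebra.pow_mem _ (ratio_mem (hs hb) hi') _
  · exact Subalgebra.pow_mem _ (pole_mem hi' (hs hu) (ne_of_mem_of_not_mem hu hi).symm) _

/-- Iterated commutators on a product of a function free of `x_k` and one free of `x_i`. -/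
theorem IsPFTerm.ct_ct_mul {b : Fin n} {P Q : typeA 𝔽 n} (hik : i ≠ k) (hi : i ∉ S) (hk : k ∉ S)
    (hb : b ∈ S) (hP : IsPFTerm i b S P) (hQ : IsPFTerm k b S Q) (j l : Fin n) :
    ct 𝔽 i j (ct 𝔽 k l (P * Q)) = ct 𝔽 i j P * ct 𝔽 k l Q ∧
      ct 𝔽 k l (ct 𝔽 i j (P * Q)) = ct 𝔽 i j P * ct 𝔽 k l Q := by
  have hi' : i ∉ insert k S := by simp [hik, hi]
  have hk' : k ∉ insert i S := by simp [hik.symm, hk]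
  obtain ⟨c, hc, -⟩ := hP.exists_ct_eq hi j
  obtain ⟨d, hd, -⟩ := hQ.exists_ct_eq hk l
  constructor
  · rw [ct_mul hk' (hP.mem_typeAOn hi hb), hd, ct_mul' hi (Subalgebra.algebraMap_mem _ d)]
  · rw [ct_mul' hi' (hQ.mem_typeAOn hk hb), hc, ct_mul hk (Subalgebra.algebraMap_mem _ c)]

/-- A partial fraction term involves at most one variable besides `x_k`. -/
theorem IsPFTerm.exists_mem_pair {b : Fin n} {Q : typeA 𝔽 n} (hk : k ∉ S) (hb : b ∈ S)
    (hQ : IsPFTerm k b S Q) : ∃ v ∈ S, Q ∈ typeAOn 𝔽 {k, v} := by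
  have h : ∀ v : Fin n, k ∈ ({k, v} : Finset (Fin n)) := fun v => by simp
  have h' : ∀ v : Fin n, v ∈ ({k, v} : Finset (Fin n)) := fun v => by simp
  rcases hQ with ⟨a, rfl⟩ | ⟨a, rfl⟩ | ⟨u, hu, m, rfl⟩
  · exact ⟨b, hb, Subalgebra.pow_mem _ (ratio_mem (h b) (h' b)) _⟩
  · exact ⟨b, hb, Subalgebra.pow_mem _ (ratio_mem (h' b) (h b)) _⟩
  · exact ⟨u, hu, Subalgebra.pow_mem _
      (pole_mem (h u) (h' u) (ne_of_mem_of_not_mem hu hk).symm) _⟩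

theorem univ_eq_insert_insert (i k : Fin n) :
    insert i (insert k (Finset.univ.filter fun a => a ≠ i ∧ a ≠ k)) = Finset.univ := by
  ext a
  simp only [Finset.mem_insert, Finset.mem_filter, Finset.mem_univ, true_and, iff_true]
  tauto

theorem ct_ct_eq_zero_of_notMem {T : Finset (Fin n)} {F : typeA 𝔽 n} (hF : F ∈ typeAOn 𝔽 S)
    (hT : S.erase k ⊆ T) (hj : j ∉ T) (i l : Fin n) : ct 𝔽 i j (ct 𝔽 k l F) = 0 :=
  ct_typeAOn_of_notMem_right hj (typeAOn_mono hT (ct_mem_erase hF k l)) i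

/-- Commutators without a common index commute. -/
theorem ct_mul_comm (hik : i ≠ k) (hil : i ≠ l) (hjk : j ≠ k) (hjl : j ≠ l) :
    ct 𝔽 i j * ct 𝔽 k l = ct 𝔽 k l * ct 𝔽 i j := by
  rcases eq_or_ne i j with rfl | hij
  · rw [ct_self, zero_mul, mul_zero]
  set S : Finset (Fin n) := Finset.univ.filter fun a => a ≠ i ∧ a ≠ k with hS
  have hi : i ∉ S := by simp [hS]
  have hk : k ∉ S := by simp [hS]
  have hj : j ∈ S := by simp [hS, hij.symm, hjk]
  refine sub_eq_zero.mp (end_eq_zero_of_pfTerm hik hi hk hj (univ_eq_insert_insert i k) _ ?_ ?_)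
  · intro c hc F
    simp only [LinearMap.sub_apply, Module.End.mul_apply, ct_mul hi hc, ct_mul hk hc, mul_sub]
  · intro P Q hP hQ
    simp only [LinearMap.sub_apply, Module.End.mul_apply]
    rcases hP.of_insert with hP | ⟨m, rfl⟩
    · rw [(hP.ct_ct_mul hik hi hk hj hQ j l).1, (hP.ct_ct_mul hik hi hk hj hQ j l).2, sub_self]
    · have hi' : i ∉ insert k S := by simp [hik, hi]
      have h1 : ct 𝔽 i j (pole 𝔽 i k ^ (m + 1) * Q) = 0 := by
        rw [ct_mul' hi' (hQ.mem_typeAOn hk hj), ct_pole_pow hik.symm hij, if_neg hjk.symm,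
          zero_mul]
      rw [h1, map_zero, sub_zero]
      -- It remains to kill [i,j][k,l] on a function of x_i, x_k, x_v. If v = l, then [k,l] leaves
      -- only x_i and x_l, and x_j is absent; otherwise x_l is absent from the start.
      obtain ⟨v, hv, hQv⟩ := hQ.exists_mem_pair hk hj
      have hPQ : pole 𝔽 i k ^ (m + 1) * Q ∈ typeAOn 𝔽 {i, k, v} :=
        Subalgebra.mul_mem _ (Subalgebra.pow_mem _ (pole_mem (by simp) (by simp) hik) _)
          (typeAOn_mono (Finset.subset_insert _ _) hQv)
      by_cases hvl : v = l
      · refine ct_ct_eq_zero_of_notMem (T := {i, v}) hPQ ?_ ?_ _ _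
        · intro a
          simp only [Finset.mem_erase, Finset.mem_insert, Finset.mem_singleton]
          tauto
        · simp [hij.symm, hvl, hjl]
      · rcases eq_or_ne k l with rfl | hkl
        · simp [ct_self]
        rw [ct_typeAOn_of_notMem_right _ hPQ k, map_zero]
        simp only [Finset.mem_insert, Finset.mem_singleton]
        exact fun h => h.elim (fun h => hil h.symm) fun h =>
          h.elim (fun h => hkl h.symm) fun h => hvl h.symm

/-- The residues at `x_k = x_i` and `x_k = x_j` of a function that vanishes at `x_k = 0` and at
`x_k = ∞` cancel. -/
theorem ct_add_ct_pole_mul_pole (hik : i ≠ k) (hjk : j ≠ k) (hij : i ≠ j) (m p : ℕ) :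
    ct 𝔽 k i (pole 𝔽 i k ^ (m + 1) * pole 𝔽 k j ^ (p + 1)) +
      ct 𝔽 k j (pole 𝔽 i k ^ (m + 1) * pole 𝔽 k j ^ (p + 1)) = 0 := by
  set Φ : Module.End 𝔽 (typeA 𝔽 n) := ct 𝔽 k i + ct 𝔽 k j with hΦ
  set f : ℕ → ℕ → typeA 𝔽 n := fun m p => pole 𝔽 i k ^ m * pole 𝔽 k j ^ p with hf
  have hkS : k ∉ ({i, j} : Finset (Fin n)) := by simp [hik.symm, hjk.symm]
  have hc : pole 𝔽 i j ∈ typeAOn 𝔽 {i, j} := pole_mem (by simp) (by simp) hij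
  have hlin : ∀ F, Φ (pole 𝔽 i j * F) = pole 𝔽 i j * Φ F := fun F => by
    simp only [hΦ, LinearMap.add_apply, ct_mul hkS hc, mul_add]
  -- Partial fractions in x_k with coefficient free of x_k. The boundary values are 0 at (0,0), 1 at
  -- (0,p+1) and -1 at (m+1,0), so they cancel in the double induction.
  have hrec : ∀ m p, f (m + 1) (p + 1) =
      pole 𝔽 i j * (f m (p + 1) - f m p + f (m + 1) p) := by
    intro m p
    have h1 := pole_mul_pole 𝔽 (i := k) hik hjk hij
    have h2 := pole_swap 𝔽 hik.symm
    simp only [hf, pow_succ, h2]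
    linear_combination (-((1 - pole 𝔽 k i) ^ m * pole 𝔽 k j ^ p)) * h1
  have h00 : Φ (f 0 0) = 0 := by simp [hΦ, hf, ct_one]
  have h0p : ∀ p, Φ (f 0 (p + 1)) = 1 := fun p => by
    simp only [hΦ, hf, pow_zero, one_mul, LinearMap.add_apply]
    rw [ct_pole_pow hjk hik.symm, if_neg hij.symm, ct_pole_pow hjk hjk.symm, if_pos rfl, zero_add]
  have hm0 : ∀ m, Φ (f (m + 1) 0) = -1 := fun m => by
    have h1 : pole 𝔽 i k ^ (m + 1) ∈ typeAOn 𝔽 {i, k} :=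
      Subalgebra.pow_mem _ (pole_mem (by simp) (by simp) hik) _
    simp only [hΦ, hf, pow_zero, mul_one, LinearMap.add_apply]
    rw [ct_pole_swap_pow hik.symm, ct_typeAOn_of_notMem_right _ h1, add_zero]
    simp [hij.symm, hjk]
  have key : ∀ m p, Φ (f (m + 1) (p + 1)) = 0 := by
    intro m
    induction m with
    | zero =>
      intro p
      induction p with
      | zero =>
        rw [hrec, hlin, map_add, map_sub, h0p, h00, hm0]
        ring
      | succ p ih =>
        rw [hrec, hlin, map_add, map_sub, h0p, h0p, ih]
        ring
    | succ m ihm =>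
      intro p
      induction p with
      | zero =>
        rw [hrec, hlin, map_add, map_sub, ihm, hm0, hm0]
        ring
      | succ p ih =>
        rw [hrec, hlin, map_add, map_sub, ihm, ihm, ih]
        ring
  exact key m p

/-- The Laurent case of `ct_mul_ct`: a power of x_k/x_j or of its inverse is split through x_i as R
R'. Then [k,i](PR) is a function of x_i alone, hence a scalar, while [k,j](PR) = 0 because x_j is
absent. -/
theorem ct_ct_add_ct_ct_ratio (hik : i ≠ k) (hjk : j ≠ k) (hij : i ≠ j) {P R R' : typeA 𝔽 n}
    (hP : P ∈ typeAOn 𝔽 {i, k}) (hR : R ∈ typeAOn 𝔽 {i, k}) (hR' : R' ∈ typeAOn 𝔽 {i, j})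
    (h : ct 𝔽 i j R' = 0) : ct 𝔽 i j (ct 𝔽 k i (P * (R * R'))) = 0 ∧
      ct 𝔽 i j (ct 𝔽 k j (P * (R * R'))) = 0 := by
  have hkS : k ∉ ({i, j} : Finset (Fin n)) := by simp [hik.symm, hjk.symm]
  have hPR := Subalgebra.mul_mem _ hP hR
  rw [← mul_assoc, ct_mul' hkS hR', ct_mul' hkS hR']
  constructor
  · have h1 := ct_mem_erase hPR k i
    rw [typeAOn_subsingleton (i := i)] at h1
    · obtain ⟨c, hc⟩ := Algebra.mem_bot.mp h1
      rw [← hc, ← Algebra.smul_def, map_smul, h, smul_zero]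
    · intro a
      simp only [Finset.mem_erase, Finset.mem_insert, Finset.mem_singleton]
      tauto
  · rw [ct_typeAOn_of_notMem_right _ hPR, zero_mul, map_zero]
    simp [hij.symm, hjk]

/-- Interchanging two commutators with the same second index. -/
theorem ct_mul_ct (hik : i ≠ k) (hjk : j ≠ k) (hij : i ≠ j) :
    ct 𝔽 k j * ct 𝔽 i j = ct 𝔽 i j * ct 𝔽 k j + ct 𝔽 i j * ct 𝔽 k i := by
  set S : Finset (Fin n) := Finset.univ.filter fun a => a ≠ i ∧ a ≠ k with hS
  have hi : i ∉ S := by simp [hS]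
  have hk : k ∉ S := by simp [hS]
  have hj : j ∈ S := by simp [hS, hij.symm, hjk]
  refine sub_eq_zero.mp (end_eq_zero_of_pfTerm hik hi hk hj (univ_eq_insert_insert i k) _ ?_ ?_)
  · intro c hc F
    simp only [LinearMap.sub_apply, LinearMap.add_apply, Module.End.mul_apply, ct_mul hi hc,
      ct_mul hk hc, mul_sub, mul_add]
  · intro P Q hP hQ
    simp only [LinearMap.sub_apply, LinearMap.add_apply, Module.End.mul_apply]
    rcases hP.of_insert with hP | ⟨m, rfl⟩
    · have h0 : ct 𝔽 k i Q = 0 :=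
        ct_typeAOn_of_notMem_right (by simp [hik, hi]) (hQ.mem_typeAOn hk hj) k
      rw [(hP.ct_ct_mul hik hi hk hj hQ j j).1, (hP.ct_ct_mul hik hi hk hj hQ j j).2,
        (hP.ct_ct_mul hik hi hk hj hQ j i).1, h0]
      ring
    · have hi' : i ∉ insert k S := by simp [hik, hi]
      have h1 : ct 𝔽 i j (pole 𝔽 i k ^ (m + 1) * Q) = 0 := by
        rw [ct_mul' hi' (hQ.mem_typeAOn hk hj), ct_pole_pow hik.symm hij, if_neg hjk.symm,
          zero_mul]
      -- The order with [i,j] first gives zero, since the pole of P lies at x_k. What remains is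
      -- that the two contributions of [k,j] and [k,i] cancel after [i,j].
      rw [h1, map_zero, zero_sub, neg_eq_zero]
      have hP : pole 𝔽 i k ^ (m + 1) ∈ typeAOn 𝔽 {i, k} :=
        Subalgebra.pow_mem _ (pole_mem (by simp) (by simp) hik) _
      rcases hQ with ⟨a, rfl⟩ | ⟨a, rfl⟩ | ⟨u, hu, p, rfl⟩
      · rw [← ratio_mul_ratio 𝔽 k i j, mul_pow]
        obtain ⟨e1, e2⟩ := ct_ct_add_ct_ct_ratio hik hjk hij hP
          (Subalgebra.pow_mem _ (ratio_mem (𝔽 := 𝔽) (u := k) (v := i) (by simp) (by simp)) a)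
          (Subalgebra.pow_mem _ (ratio_mem (𝔽 := 𝔽) (u := i) (v := j) (by simp) (by simp)) a)
          (ct_ratio_pow j a)
        rw [e1, e2, add_zero]
      · rw [← ratio_mul_ratio 𝔽 j i k, mul_comm (ratio 𝔽 j i), mul_pow]
        obtain ⟨e1, e2⟩ := ct_ct_add_ct_ct_ratio hik hjk hij hP
          (Subalgebra.pow_mem _ (ratio_mem (𝔽 := 𝔽) (u := i) (v := k) (by simp) (by simp)) a)
          (Subalgebra.pow_mem _ (ratio_mem (𝔽 := 𝔽) (u := j) (v := i) (by simp) (by simp)) a)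
          (ct_ratio_swap_pow j a)
        rw [e1, e2, add_zero]
      · rcases eq_or_ne u j with rfl | huj
        · rw [add_comm, ← map_add, ct_add_ct_pole_mul_pole hik hjk hij, map_zero]
        · have huk := ne_of_mem_of_not_mem hu hk
          have hPQ : pole 𝔽 i k ^ (m + 1) * pole 𝔽 k u ^ (p + 1) ∈ typeAOn 𝔽 {i, k, u} :=
            Subalgebra.mul_mem _ (Subalgebra.pow_mem _ (pole_mem (by simp) (by simp) hik) _)
              (Subalgebra.pow_mem _ (pole_mem (by simp) (by simp) huk.symm) _)
          rw [ct_typeAOn_of_notMem_right _ hPQ, map_zero, zero_add]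
          · refine ct_ct_eq_zero_of_notMem (T := {i, u}) hPQ ?_ ?_ _ _
            · intro a
              simp only [Finset.mem_erase, Finset.mem_insert, Finset.mem_singleton]
              tauto
            · simp [hij.symm, huj.symm]
          · simp [hij.symm, hjk, huj.symm]

/-- Reversing the first step of a path `k → i → j`. -/
theorem ct_mul_ct_chain (hik : i ≠ k) (hjk : j ≠ k) (hij : i ≠ j) :
    ct 𝔽 i j * ct 𝔽 k i = -(ct 𝔽 k j * ct 𝔽 i k) := by
  -- Adding the exchange relation to the one with i and k interchanged cancels the products with
  -- common second index j.
  have h1 := ct_mul_ct (𝔽 := 𝔽) hik hjk hij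
  have h2 := ct_mul_ct (𝔽 := 𝔽) hik.symm hij.symm hjk.symm
  refine LinearMap.ext fun F => ?_
  have h3 := LinearMap.congr_fun h1 F
  have h4 := LinearMap.congr_fun h2 F
  simp only [LinearMap.add_apply, LinearMap.neg_apply] at h3 h4 ⊢
  linear_combination -h3 - h4

/-- Nothing can be done with `x_i` after a commutator `[i,j]`. -/
theorem ct_mul_ct_eq_zero (h : k = i ∨ l = i) (j : Fin n) : ct 𝔽 k l * ct 𝔽 i j = 0 := by
  refine LinearMap.ext fun F => ?_
  have hF := ct_mem_erase (mem_typeAOn_univ F) i j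
  rcases h with rfl | rfl
  · exact ct_typeAOn_of_notMem_left (Finset.notMem_erase _ _) hF
  · exact ct_typeAOn_of_notMem_right (Finset.notMem_erase _ _) hF k

end Relations

/-! ### A function is determined by its constant terms -/

section Detect

variable {𝔽 : Type*} [Field 𝔽] {n : ℕ} {a b : Fin n}

theorem aeval_mem_laurent (i : Fin n) (p : (freeOf 𝔽 i)[X]) :
    Polynomial.aeval (x 𝔽 i) p ∈
      Submodule.span (freeOf 𝔽 i) (Set.range fun k : ℤ => x 𝔽 i ^ k) := by
  induction p using Polynomial.induction_on' with
  | add p q hp hq => rw [map_add]; exact Submodule.add_mem _ hp hq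
  | monomial m c =>
    rw [Polynomial.aeval_monomial, ← Algebra.smul_def]
    exact Submodule.smul_mem _ _ (Submodule.subset_span ⟨m, by simp⟩)

theorem algebraMap_mem_range_aeval (i : Fin n) (p : MvPolynomial (Fin n) 𝔽) :
    ∃ P : (freeOf 𝔽 i)[X],
      Polynomial.aeval (x 𝔽 i) P = algebraMap (MvPolynomial (Fin n) 𝔽) (RatFun 𝔽 n) p := by
  induction p using MvPolynomial.induction_on with
  | C c => exact ⟨Polynomial.C (algebraMap 𝔽 _ c), by rw [Polynomial.aeval_C]; rfl⟩
  | add p q hp hq =>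
    obtain ⟨P, hP⟩ := hp
    obtain ⟨Q, hQ⟩ := hq
    exact ⟨P + Q, by rw [map_add, map_add, hP, hQ]⟩
  | mul_X p u hp =>
    obtain ⟨P, hP⟩ := hp
    rcases eq_or_ne u i with rfl | hu
    · exact ⟨P * Polynomial.X, by rw [map_mul, map_mul, hP, Polynomial.aeval_X]; rfl⟩
    · refine ⟨P * Polynomial.C ⟨x 𝔽 u, x_mem_freeOf 𝔽 hu⟩, ?_⟩
      rw [map_mul, map_mul, hP, Polynomial.aeval_C]
      rfl

/-- With t = 1 - x_a/x_b one has x_a = x_b - x_b t, so a factor x_a only shifts the exponent m.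
Vanishing against all powers of t thus extends to polynomials in x_a. -/
theorem hasCT_aeval_mul {F : RatFun 𝔽 n} (hab : a ≠ b)
    (h : ∀ m : ℤ, HasCT a b ((1 - x 𝔽 a / x 𝔽 b) ^ m * F) 0) (p : (freeOf 𝔽 a)[X]) (m : ℤ) :
    HasCT a b (Polynomial.aeval (x 𝔽 a) p * ((1 - x 𝔽 a / x 𝔽 b) ^ m * F)) 0 := by
  have ht := one_sub_ne_zero 𝔽 hab
  have hb := x_ne_zero 𝔽 b
  set xb : freeOf 𝔽 a := ⟨x 𝔽 b, x_mem_freeOf 𝔽 hab.symm⟩ with hxb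
  have hX : ∀ (k : ℕ) (m : ℤ),
      HasCT a b (x 𝔽 a ^ k * ((1 - x 𝔽 a / x 𝔽 b) ^ m * F)) 0 := by
    intro k
    induction k with
    | zero => simpa using h
    | succ k ih =>
      intro m
      have h1 := (ih m).smul_add xb ((ih (m + 1)).smul_add (-xb) (hasCT_zero a b))
      have e : (xb : RatFun 𝔽 n) = x 𝔽 b := rfl
      rw [NegMemClass.coe_neg, e] at h1
      convert h1 using 1
      · rw [zpow_add_one₀ ht]
        field_simp
        ring
      · ring
  induction p using Polynomial.induction_on' with
  | add p q hp hq =>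
    have := hp.smul_add 1 hq
    simpa [add_mul] using this
  | monomial k c =>
    have := (hX k m).smul_add c (hasCT_zero a b)
    rw [Polynomial.aeval_monomial]
    simpa [mul_assoc, IntermediateField.algebraMap_apply] using this

/-- The polynomial p - p(x_b) is divisible by x_a - x_b, which cancels the simple pole; only
p(x_b)/(1 - x_a/x_b) contributes. -/
theorem hasCT_aeval_mul_inv (hab : a ≠ b) (p : (freeOf 𝔽 a)[X]) :
    HasCT a b (Polynomial.aeval (x 𝔽 a) p * (1 - x 𝔽 a / x 𝔽 b)⁻¹)
      (p.eval ⟨x 𝔽 b, x_mem_freeOf 𝔽 hab.symm⟩ : freeOf 𝔽 a) := by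
  have ht := one_sub_ne_zero 𝔽 hab
  have hb := x_ne_zero 𝔽 b
  set xb : freeOf 𝔽 a := ⟨x 𝔽 b, x_mem_freeOf 𝔽 hab.symm⟩ with hxb
  have e : (xb : RatFun 𝔽 n) = x 𝔽 b := rfl
  obtain ⟨r, hr⟩ := Polynomial.X_sub_C_dvd_sub_C_eval (a := xb) (p := p)
  have h1 := hasCT_pole (𝔽 := 𝔽) a b hab.symm one_pos
  have h2 := h1.smul_add (p.eval xb) ((hasCT_of_laurent a b (aeval_mem_laurent a r)).smul_add (-xb)
    (hasCT_zero a b))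
  have h3 := congrArg (Polynomial.aeval (x 𝔽 a)) hr
  simp only [map_sub, map_mul, Polynomial.aeval_X, Polynomial.aeval_C,
    IntermediateField.algebraMap_apply, e] at h3
  have h4 : x 𝔽 a - x 𝔽 b = -x 𝔽 b * (1 - x 𝔽 a / x 𝔽 b) := by
    field_simp
    ring
  rw [NegMemClass.coe_neg, e] at h2
  convert h2 using 1
  · rw [pow_one, sub_eq_iff_eq_add.mp h3, h4]
    linear_combination (-x 𝔽 b * Polynomial.aeval (x 𝔽 a) r) * mul_inv_cancel₀ ht
  · simp

theorem hasCT_zero_of_ct_eq_zero (hab : a ≠ b) {F : typeA 𝔽 n} (h : ct 𝔽 a b F = 0)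
    {f : RatFun 𝔽 n} (hf : (F : RatFun 𝔽 n) = f) : HasCT a b f 0 := by
  have h0 := ct_spec 𝔽 hab F
  rw [h, hf] at h0
  exact h0

/-- If `[a,b](g G) = 0` for all functions `g` of `x_a` and `x_b`, then `G = 0`. -/
theorem eq_zero_of_ct_mul_eq_zero (hab : a ≠ b) {G : typeA 𝔽 n}
    (h : ∀ g ∈ typeAOn 𝔽 {a, b}, ct 𝔽 a b (g * G) = 0) : G = 0 := by
  have ht := one_sub_ne_zero 𝔽 hab
  have hb := x_ne_zero 𝔽 b
  have ha' : a ∈ ({a, b} : Finset (Fin n)) := by simp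
  have hb' : b ∈ ({a, b} : Finset (Fin n)) := by simp
  -- Only the integral powers of t = 1 - x_a/x_b are needed as test functions g.
  have h1 : ∀ m : ℤ, HasCT a b ((1 - x 𝔽 a / x 𝔽 b) ^ m * (G : RatFun 𝔽 n)) 0 := by
    intro m
    obtain ⟨k, rfl | rfl⟩ := Int.eq_nat_or_neg m
    · have h2 : 1 - ratio 𝔽 a b ∈ typeAOn 𝔽 {a, b} :=
        Subalgebra.sub_mem _ (Subalgebra.one_mem _) (ratio_mem ha' hb')
      refine hasCT_zero_of_ct_eq_zero hab (h _ (Subalgebra.pow_mem _ h2 k)) ?_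
      rw [zpow_natCast, MulMemClass.coe_mul, SubmonoidClass.coe_pow, AddSubgroupClass.coe_sub,
        OneMemClass.coe_one, coe_ratio]
    · have h2 : pole 𝔽 a b ∈ typeAOn 𝔽 {a, b} := pole_mem ha' hb' hab
      refine hasCT_zero_of_ct_eq_zero hab (h _ (Subalgebra.pow_mem _ h2 k)) ?_
      rw [zpow_neg, zpow_natCast, ← inv_pow, MulMemClass.coe_mul, SubmonoidClass.coe_pow, coe_pole]
  by_contra hG
  have hG' : (G : RatFun 𝔽 n) ≠ 0 := fun e => hG (Subtype.ext e)
  set xb : freeOf 𝔽 a := ⟨x 𝔽 b, x_mem_freeOf 𝔽 hab.symm⟩ with hxb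
  have e : (xb : RatFun 𝔽 n) = x 𝔽 b := rfl
  obtain ⟨p₀, q₀, hq₀, hpq⟩ :=
    IsFractionRing.div_surjective (A := MvPolynomial (Fin n) 𝔽) (G : RatFun 𝔽 n)
  obtain ⟨p, hp⟩ := algebraMap_mem_range_aeval a p₀
  obtain ⟨d, hd⟩ := algebraMap_mem_range_aeval a q₀
  have hq0 : algebraMap (MvPolynomial (Fin n) 𝔽) (RatFun 𝔽 n) q₀ ≠ 0 :=
    IsFractionRing.to_map_ne_zero_of_mem_nonZeroDivisors hq₀
  have hdG : Polynomial.aeval (x 𝔽 a) d * (G : RatFun 𝔽 n) = Polynomial.aeval (x 𝔽 a) p := by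
    rw [hd, hp, ← hpq]
    field_simp
  have hp0 : p ≠ 0 := by
    rintro rfl
    rw [map_zero, hd] at hdG
    exact (mul_ne_zero hq0 hG') hdG
  -- Here dG = p. If p vanishes to order v at x_a = x_b, then d t^(-(v+1)) G has a simple pole
  -- there, with constant term (-x_b)^v r(x_b), which is nonzero although the hypothesis forces it
  -- to vanish.
  obtain ⟨r, hr, hr'⟩ := Polynomial.exists_eq_pow_rootMultiplicity_mul_and_not_dvd p hp0 xb
  set v := p.rootMultiplicity xb
  have h2 := hasCT_aeval_mul hab h1 d (-(v + 1 : ℕ))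
  have h3 := (hasCT_aeval_mul_inv hab r).smul_add ((-xb) ^ v) (hasCT_zero a b)
  have h4 := congrArg (Polynomial.aeval (x 𝔽 a)) hr
  simp only [map_sub, map_mul, map_pow, Polynomial.aeval_X, Polynomial.aeval_C,
    IntermediateField.algebraMap_apply, e] at h4
  have h5 : x 𝔽 a - x 𝔽 b = -x 𝔽 b * (1 - x 𝔽 a / x 𝔽 b) := by
    field_simp
    ring
  have h6 : Polynomial.aeval (x 𝔽 a) d *
      ((1 - x 𝔽 a / x 𝔽 b) ^ (-(v + 1 : ℕ) : ℤ) * (G : RatFun 𝔽 n)) =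
      ((-xb) ^ v : freeOf 𝔽 a) *
        (Polynomial.aeval (x 𝔽 a) r * (1 - x 𝔽 a / x 𝔽 b)⁻¹) + 0 := by
    rw [mul_left_comm, hdG, h4, h5, mul_pow, zpow_neg, zpow_natCast, pow_succ, SubmonoidClass.coe_pow,
      NegMemClass.coe_neg, e, add_zero]
    generalize 1 - x 𝔽 a / x 𝔽 b = t at ht ⊢
    field_simp
  rw [h6] at h2
  have h7 := h3.unique hab.symm h2
  rw [add_zero, mul_eq_zero] at h7
  rcases h7 with h7 | h7
  · rw [SubmonoidClass.coe_pow, NegMemClass.coe_neg, e] at h7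
    exact (pow_ne_zero v (neg_ne_zero.mpr hb)) h7
  · exact hr' (Polynomial.dvd_iff_isRoot.mpr (Subtype.ext h7))

end Detect

/-! ### Words of commutators -/

section Words

variable {𝔽 : Type*} [Field 𝔽] {n : ℕ} {S : Finset (Fin n)}

theorem wordOp_nil : wordOp 𝔽 ([] : List (Fin n × Fin n)) = 1 := rfl

theorem wordOp_cons (p : Fin n × Fin n) (w : List (Fin n × Fin n)) :
    wordOp 𝔽 (p :: w) = ct 𝔽 p.1 p.2 * wordOp 𝔽 w := by
  simp [wordOp]

theorem wordOp_append (w w' : List (Fin n × Fin n)) :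
    wordOp 𝔽 (w ++ w') = wordOp 𝔽 w * wordOp 𝔽 w' := by
  simp [wordOp]

theorem wordOp_singleton (p : Fin n × Fin n) : wordOp 𝔽 [p] = ct 𝔽 p.1 p.2 := by
  simp [wordOp]

theorem wordOp_mem (w : List (Fin n × Fin n)) {F : typeA 𝔽 n} (hF : F ∈ typeAOn 𝔽 S) :
    wordOp 𝔽 w F ∈ typeAOn 𝔽 (S \ (w.map Prod.fst).toFinset) := by
  induction w with
  | nil => simpa [wordOp_nil] using hF
  | cons p w ih =>
    rw [wordOp_cons, Module.End.mul_apply]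
    refine typeAOn_mono ?_ (ct_mem_erase ih p.1 p.2)
    intro a
    simp only [Finset.mem_erase, Finset.mem_sdiff, List.map_cons, List.toFinset_cons,
      Finset.mem_insert]
    tauto

theorem wordOp_apply_mem (w : List (Fin n × Fin n)) (F : typeA 𝔽 n) :
    wordOp 𝔽 w F ∈ typeAOn 𝔽 (w.map Prod.fst).toFinsetᶜ := by
  rw [Finset.compl_eq_univ_sdiff]
  exact wordOp_mem w (mem_typeAOn_univ F)

theorem wordOp_mul (w : List (Fin n × Fin n)) (h : ∀ p ∈ w, p.1 ∉ S) {c : typeA 𝔽 n}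
    (hc : c ∈ typeAOn 𝔽 S) (F : typeA 𝔽 n) : wordOp 𝔽 w (c * F) = c * wordOp 𝔽 w F := by
  induction w with
  | nil => rfl
  | cons p w ih =>
    rw [wordOp_cons, Module.End.mul_apply, Module.End.mul_apply,
      ih fun q hq => h q (List.mem_cons_of_mem p hq), ct_mul (h p List.mem_cons_self) hc]

theorem ct_mul_wordOp_eq_zero {i j : Fin n} (w : List (Fin n × Fin n))
    (h : i ∈ w.map Prod.fst ∨ j ∈ w.map Prod.fst) : ct 𝔽 i j * wordOp 𝔽 w = 0 := by
  refine LinearMap.ext fun F => ?_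
  have hF := wordOp_apply_mem w F
  rcases h with h | h
  · exact ct_typeAOn_of_notMem_left (by simpa using h) hF
  · exact ct_typeAOn_of_notMem_right (by simpa using h) hF i

/-- In a nonzero word, an index that has been eliminated is not used any more. -/
theorem pairwise_of_wordOp_ne_zero {w : List (Fin n × Fin n)} (h : wordOp 𝔽 w ≠ 0) :
    (∀ p ∈ w, p.1 ≠ p.2) ∧ w.Pairwise fun p q => p.1 ≠ q.1 ∧ p.2 ≠ q.1 := by
  induction w with
  | nil => simp
  | cons p w ih =>
    rw [wordOp_cons] at h
    have hw : wordOp 𝔽 w ≠ 0 := right_ne_zero_of_mul h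
    obtain ⟨h1, h2⟩ := ih hw
    refine ⟨?_, ?_⟩
    · intro q hq
      rcases List.mem_cons.mp hq with rfl | hq
      · intro e
        rw [e, ct_self, zero_mul] at h
        exact h rfl
      · exact h1 q hq
    · refine List.pairwise_cons.mpr ⟨fun q hq => ⟨fun e => h ?_, fun e => h ?_⟩, h2⟩
      · exact ct_mul_wordOp_eq_zero w (Or.inl (e ▸ List.mem_map_of_mem hq))
      · exact ct_mul_wordOp_eq_zero w (Or.inr (e ▸ List.mem_map_of_mem hq))

theorem nodup_of_wordOp_ne_zero {w : List (Fin n × Fin n)} (h : wordOp 𝔽 w ≠ 0) :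
    (w.map Prod.fst).Nodup :=
  List.pairwise_map.mpr ((pairwise_of_wordOp_ne_zero h).2.imp fun h => h.1)

theorem length_lt_of_wordOp_ne_zero (hn : 1 ≤ n) {w : List (Fin n × Fin n)}
    (h : wordOp 𝔽 w ≠ 0) : w.length < n := by
  rcases w with _ | ⟨p, w⟩
  · exact hn
  · obtain ⟨h1, h2⟩ := pairwise_of_wordOp_ne_zero h
    -- The second index of the leftmost letter is not eliminated by the word, so it adds one more
    -- index to the distinct first indices.
    have h3 : (p.2 :: ((p :: w).map Prod.fst)).Nodup := by
      refine List.nodup_cons.mpr ⟨?_, nodup_of_wordOp_ne_zero h⟩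
      rw [List.map_cons, List.mem_cons, not_or]
      refine ⟨(h1 p List.mem_cons_self).symm, ?_⟩
      rintro h4
      obtain ⟨q, hq, e⟩ := List.mem_map.mp h4
      exact ((List.pairwise_cons.mp h2).1 q hq).2 e.symm
    have := h3.length_le_card
    simp only [List.length_cons, List.length_map, Fintype.card_fin] at this ⊢
    exact this

/-- `Ξ` is the sum of the `Ξ^s` with `s < n`. -/
theorem iSup_XiDeg (hn : 1 ≤ n) :
    ⨆ s : Fin n, XiDeg 𝔽 n s = Subalgebra.toSubmodule (Xi 𝔽 n) := by
  apply le_antisymm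
  · refine iSup_le fun s => Submodule.span_le.mpr ?_
    rintro _ ⟨-, w, hw, -, rfl⟩
    refine Subalgebra.list_prod_mem _ ?_
    intro T hT
    obtain ⟨p, hp, rfl⟩ := List.mem_map.mp hT
    exact Algebra.subset_adjoin ⟨p.1, p.2, hw p hp, rfl⟩
  · rw [Xi, Algebra.adjoin_eq_span]
    refine Submodule.span_le.mpr fun T hT => ?_
    obtain ⟨l, hl, rfl⟩ := Submonoid.exists_list_of_mem_closure hT
    have key : ∃ w : List (Fin n × Fin n), (∀ p ∈ w, p.1 ≠ p.2) ∧ l.prod = wordOp 𝔽 w := by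
      clear hT
      induction l with
      | nil => exact ⟨[], by simp, rfl⟩
      | cons T l ih =>
        obtain ⟨w, hw, e⟩ := ih fun T hT => hl T (List.mem_cons_of_mem _ hT)
        obtain ⟨i, j, hij, rfl⟩ := hl T List.mem_cons_self
        refine ⟨(i, j) :: w, ?_, by rw [List.prod_cons, e, wordOp_cons]⟩
        intro p hp
        rcases List.mem_cons.mp hp with rfl | hp
        · exact hij
        · exact hw p hp
    obtain ⟨w, hw, e⟩ := key
    rw [e]
    by_cases h0 : wordOp 𝔽 w = 0
    · rw [h0]
      exact Submodule.zero_mem _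
    · exact Submodule.mem_iSup_of_mem ⟨w.length, length_lt_of_wordOp_ne_zero hn h0⟩
        (Submodule.subset_span ⟨h0, w, hw, rfl, rfl⟩)

/-! ### Independence of the degrees -/

variable (𝔽) in
/-- The span of the words that eliminate exactly the variables with index in `S`. -/
def elimSpan (S : Finset (Fin n)) : Submodule 𝔽 (Module.End 𝔽 (typeA 𝔽 n)) :=
  Submodule.span 𝔽 {T | ∃ w : List (Fin n × Fin n), (w.map Prod.fst).toFinset = S ∧ T = wordOp 𝔽 w}

theorem ct_mul_elimSpan {T : Module.End 𝔽 (typeA 𝔽 n)} (hT : T ∈ elimSpan 𝔽 S) {a b : Fin n}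
    (h : a ∈ S ∨ b ∈ S) : ct 𝔽 a b * T = 0 := by
  induction hT using Submodule.span_induction with
  | mem T hT =>
    obtain ⟨w, rfl, rfl⟩ := hT
    exact ct_mul_wordOp_eq_zero w (by simpa only [List.mem_toFinset] using h)
  | zero => rw [mul_zero]
  | add T U _ _ hT hU => rw [mul_add, hT, hU, add_zero]
  | smul c T _ hT => rw [mul_smul_comm, hT, smul_zero]

theorem elimSpan_apply_mul {T : Module.End 𝔽 (typeA 𝔽 n)} (hT : T ∈ elimSpan 𝔽 S) {a b : Fin n}
    (ha : a ∉ S) (hb : b ∉ S) {g : typeA 𝔽 n} (hg : g ∈ typeAOn 𝔽 {a, b}) (F : typeA 𝔽 n) :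
    T (g * F) = g * T F := by
  induction hT using Submodule.span_induction with
  | mem T hT =>
    obtain ⟨w, rfl, rfl⟩ := hT
    refine wordOp_mul w ?_ hg F
    intro p hp h
    have hp' : p.1 ∈ (w.map Prod.fst).toFinset := List.mem_toFinset.mpr (List.mem_map_of_mem hp)
    rcases Finset.mem_insert.mp h with h | h
    · exact ha (h ▸ hp')
    · exact hb (Finset.mem_singleton.mp h ▸ hp')
  | zero => simp
  | add T U _ _ hT hU => rw [LinearMap.add_apply, LinearMap.add_apply, hT, hU, mul_add]
  | smul c T _ hT => rw [LinearMap.smul_apply, LinearMap.smul_apply, hT, mul_smul_comm]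

/-- [a,b] annihilates the terms with S meeting {a,b}, and hence also the sum of the remaining ones.
Those are linear over functions of x_a and x_b, so `eq_zero_of_ct_mul_eq_zero` applies to their
values. -/
theorem sum_filter_eq_zero {T : Finset (Fin n) → Module.End 𝔽 (typeA 𝔽 n)}
    (hT : ∀ S, T S ∈ elimSpan 𝔽 S) {s : Finset (Finset (Fin n))} (h : ∑ S ∈ s, T S = 0)
    {a b : Fin n} (hab : a ≠ b) : ∑ S ∈ s with a ∉ S ∧ b ∉ S, T S = 0 := by
  refine LinearMap.ext fun F => eq_zero_of_ct_mul_eq_zero hab fun g hg => ?_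
  have h1 : g * (∑ S ∈ s with a ∉ S ∧ b ∉ S, T S) F =
      (∑ S ∈ s with a ∉ S ∧ b ∉ S, T S) (g * F) := by
    rw [LinearMap.sum_apply, LinearMap.sum_apply, Finset.mul_sum]
    refine Finset.sum_congr rfl fun S hS => ?_
    obtain ⟨-, ha, hb⟩ := Finset.mem_filter.mp hS
    exact (elimSpan_apply_mul (hT S) ha hb hg F).symm
  have h2 : ct 𝔽 a b * ∑ S ∈ s with a ∉ S ∧ b ∉ S, T S = 0 := by
    have h3 : ct 𝔽 a b * ∑ S ∈ s with ¬(a ∉ S ∧ b ∉ S), T S = 0 := by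
      rw [Finset.mul_sum]
      refine Finset.sum_eq_zero fun S hS => ct_mul_elimSpan (hT S) ?_
      have := (Finset.mem_filter.mp hS).2
      tauto
    have h4 := Finset.sum_filter_add_sum_filter_not s (fun S => a ∉ S ∧ b ∉ S) T
    rw [h] at h4
    have h5 := congrArg (ct 𝔽 a b * ·) h4
    simpa only [mul_add, h3, add_zero, mul_zero] using h5
  rw [h1, ← Module.End.mul_apply, h2, LinearMap.zero_apply]

/-- Iterates `sum_filter_eq_zero` with a fixed and b running through R; at least one b is needed to
obtain a pair. -/
theorem sum_disjoint_eq_zero {T : Finset (Fin n) → Module.End 𝔽 (typeA 𝔽 n)}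
    (hT : ∀ S, T S ∈ elimSpan 𝔽 S) (h : ∑ S, T S = 0) (a : Fin n) {R : Finset (Fin n)}
    (hR : R.Nonempty) (ha : a ∉ R) : ∑ S with a ∉ S ∧ Disjoint R S, T S = 0 := by
  induction hR using Finset.Nonempty.cons_induction with
  | singleton b =>
    have := sum_filter_eq_zero hT h (a := a) (b := b) (by simpa using ha)
    simpa only [Finset.disjoint_singleton_left] using this
  | cons b R hb _ ih =>
    rw [Finset.mem_cons, not_or] at ha
    have := sum_filter_eq_zero hT (ih ha.2) ha.1
    rw [Finset.filter_filter] at this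
    rw [← this]
    refine Finset.sum_congr (Finset.filter_congr fun S _ => ?_) fun _ _ => rfl
    rw [Finset.cons_eq_insert, Finset.disjoint_insert_left]
    tauto

/-- With a outside S and R the rest of the complement, the surviving sets are exactly the subsets of
S, and induction removes the proper ones. The bound on the cardinality makes R nonempty. -/
theorem eq_zero_of_sum_eq_zero {T : Finset (Fin n) → Module.End 𝔽 (typeA 𝔽 n)}
    (hT : ∀ S, T S ∈ elimSpan 𝔽 S) (h : ∑ S, T S = 0) (S : Finset (Fin n))
    (hS : S.card + 2 ≤ n) : T S = 0 := by
  induction S using Finset.strongInduction with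
  | H S ih =>
    have h1 : 2 ≤ Sᶜ.card := by
      rw [Finset.card_compl, Fintype.card_fin]
      omega
    obtain ⟨a, ha⟩ := Finset.card_pos.mp (by omega : 0 < Sᶜ.card)
    have h2 : (Sᶜ.erase a).Nonempty := by
      rw [← Finset.card_pos, Finset.card_erase_of_mem ha]
      omega
    have h3 := sum_disjoint_eq_zero hT h a h2 (Finset.notMem_erase a _)
    have h4 : ∀ S' : Finset (Fin n), a ∉ S' ∧ Disjoint (Sᶜ.erase a) S' ↔ S' ⊆ S := by
      intro S'
      rw [← disjoint_compl_left_iff, ← Finset.disjoint_insert_left, Finset.insert_erase ha]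
    simp only [h4] at h3
    rw [← Finset.add_sum_erase _ _ (by simp : S ∈ Finset.univ.filter fun S' => S' ⊆ S),
      Finset.sum_eq_zero, add_zero] at h3
    · exact h3
    · intro S' hS'
      obtain ⟨hne, hS'⟩ := Finset.mem_erase.mp hS'
      have hss : S' ⊂ S := lt_of_le_of_ne (Finset.mem_filter.mp hS').2 hne
      exact ih S' hss (by have := Finset.card_lt_card hss; omega)

/-- A nonzero word has distinct first indices, so its length is the number of variables it
eliminates. -/
theorem XiDeg_le (s : ℕ) :
    XiDeg 𝔽 n s ≤ ⨆ S ∈ (Finset.univ : Finset (Fin n)).powersetCard s, elimSpan 𝔽 S := by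
  refine Submodule.span_le.mpr ?_
  rintro _ ⟨h0, w, hw, rfl, rfl⟩
  refine Submodule.mem_iSup_of_mem (w.map Prod.fst).toFinset
    (Submodule.mem_iSup_of_mem ?_ (Submodule.subset_span ⟨w, rfl, rfl⟩))
  rw [Finset.mem_powersetCard]
  exact ⟨Finset.subset_univ _, by
    rw [List.toFinset_card_of_nodup (nodup_of_wordOp_ne_zero h0), List.length_map]⟩

/-- If y in `p i` is a sum of elements of the other submodules, putting -y in place i gives a
vanishing sum. Only an additive monoid is assumed, so -y is written as (-1) • y. -/
theorem iSupIndep_of_sum_eq_zero {K M ι : Type*} [Field K] [AddCommMonoid M] [Module K M]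
    [Fintype ι] {p : ι → Submodule K M}
    (h : ∀ f : ι → M, (∀ s, f s ∈ p s) → ∑ s, f s = 0 → ∀ s, f s = 0) : iSupIndep p := by
  classical
  refine (iSupIndep_iff_forall_dfinsupp _).mpr fun i y v hv => ?_
  rw [DFinsupp.lsum_apply_apply, DFinsupp.sumAddHom_apply,
    DFinsupp.sum_eq_sum_fintype _ (fun _ => map_zero _)] at hv
  replace hv : ∑ s, (DFinsupp.erase i v s : M) = y := hv
  have hy : (y : M) + (-1 : K) • (y : M) = 0 := by
    rw [← one_smul K (y : M), smul_smul, ← add_smul, mul_one, add_neg_cancel, zero_smul]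
  have h1 := h (fun s => if s = i then (-1 : K) • (y : M) else v s) ?_ ?_ i
  · rw [if_pos rfl] at h1
    rw [h1, add_zero] at hy
    exact Subtype.ext hy
  · intro s
    split_ifs with hs
    · subst hs
      exact Submodule.smul_mem _ _ y.2
    · exact (v s).2
  · rw [← Finset.sum_erase_add _ _ (Finset.mem_univ i)] at hv ⊢
    rw [DFinsupp.erase_same, ZeroMemClass.coe_zero, add_zero] at hv
    rw [if_pos rfl, ← hy, ← hv]
    congr 1
    refine Finset.sum_congr rfl fun s hs => ?_
    have hs' := (Finset.mem_erase.mp hs).1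
    rw [if_neg hs', DFinsupp.erase_ne hs']

theorem eq_zero_of_sum_XiDeg {f : Fin n → Module.End 𝔽 (typeA 𝔽 n)}
    (hfX : ∀ s : Fin n, f s ∈ XiDeg 𝔽 n s) (hf : ∑ s, f s = 0) (s : Fin n) : f s = 0 := by
  have hex : ∀ s : Fin n, ∃ μ : ∀ S : Finset (Fin n), elimSpan 𝔽 S,
      ∑ S ∈ (Finset.univ : Finset (Fin n)).powersetCard s,
        (μ S : Module.End 𝔽 (typeA 𝔽 n)) = f s := fun s =>
    (Submodule.mem_iSup_finset_iff_exists_sum _ _).mp (XiDeg_le (s : ℕ) (hfX s))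
  choose μ hμ using hex
  -- `T S` is the S-component of the operator of degree |S|. The full set has no degree s < n, so
  -- its component is 0.
  set T : Finset (Fin n) → Module.End 𝔽 (typeA 𝔽 n) := fun S =>
    if h : S.card < n then μ ⟨S.card, h⟩ S else 0 with hTdef
  have hT : ∀ S, T S ∈ elimSpan 𝔽 S := by
    intro S
    simp only [hTdef]
    split_ifs
    · exact Subtype.prop _
    · exact Submodule.zero_mem _
  have hf' : ∀ s : Fin n, f s =
      ∑ S with S.card = (s : ℕ), T S := by
    intro s
    rw [← hμ s, ← Finset.powerset_univ, ← Finset.powersetCard_eq_filter]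
    refine Finset.sum_congr rfl fun S hS => ?_
    have hc : S.card = s := (Finset.mem_powersetCard.mp hS).2
    have e : (⟨S.card, hc ▸ s.2⟩ : Fin n) = s := Fin.ext hc
    simp only [hTdef]
    rw [dif_pos (hc ▸ s.2), e]
  have hsum : ∑ S, T S = 0 := by
    rw [← hf, Finset.sum_congr rfl fun s _ => hf' s, ← Finset.sum_fiberwise_of_maps_to
      (s := Finset.univ) (t := Finset.range (n + 1)) (g := Finset.card) (f := T),
      Finset.sum_range_succ, Finset.sum_range]
    · have h0 : ∑ S with S.card = n, T S = 0 := by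
        refine Finset.sum_eq_zero fun S hS => ?_
        simp only [hTdef]
        exact dif_neg (by rw [(Finset.mem_filter.mp hS).2]; exact lt_irrefl n)
      rw [h0, add_zero]
    · intro S _
      rw [Finset.mem_range, Nat.lt_succ_iff]
      exact card_finset_fin_le S
  have h0 : ∀ s : Fin n, (s : ℕ) + 2 ≤ n → f s = 0 := by
    intro s hs
    rw [hf' s]
    refine Finset.sum_eq_zero fun S hS => eq_zero_of_sum_eq_zero hT hsum S ?_
    rwa [(Finset.mem_filter.mp hS).2]
  by_cases hs : (s : ℕ) + 2 ≤ n
  · exact h0 s hs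
  -- Now s = n - 1: all other summands vanish, so the vanishing sum is `f s` itself.
  · rwa [Finset.sum_eq_single_of_mem s (Finset.mem_univ s)] at hf
    intro s' _ hne
    refine h0 s' ?_
    have := s'.2
    have := s.2
    have := Fin.val_ne_of_ne hne
    omega

/-- The sum of the `Ξ^s` is direct. -/
theorem iSupIndep_XiDeg : iSupIndep fun s : Fin n => XiDeg 𝔽 n s :=
  iSupIndep_of_sum_eq_zero fun _ hfX hf s => eq_zero_of_sum_XiDeg hfX hf s

end Words

/-! ### Rewriting words of commutators -/

section Rewriting

variable {𝔽 : Type*} [Field 𝔽] {n : ℕ}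

theorem mul_mem_of_mem_span_left {A : Set (Module.End 𝔽 (typeA 𝔽 n))}
    {N : Submodule 𝔽 (Module.End 𝔽 (typeA 𝔽 n))} {X U : Module.End 𝔽 (typeA 𝔽 n)}
    (hX : X ∈ Submodule.span 𝔽 A) (h : ∀ T ∈ A, T * U ∈ N) : X * U ∈ N := by
  induction hX using Submodule.span_induction with
  | mem T hT => exact h T hT
  | zero => rw [zero_mul]; exact N.zero_mem
  | add T V _ _ hT hV => rw [add_mul]; exact N.add_mem hT hV
  | smul c T _ hT => rw [smul_mul_assoc]; exact N.smul_mem c hT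

theorem mul_mem_of_mem_span_right {A : Set (Module.End 𝔽 (typeA 𝔽 n))}
    {N : Submodule 𝔽 (Module.End 𝔽 (typeA 𝔽 n))} {X U : Module.End 𝔽 (typeA 𝔽 n)}
    (hX : X ∈ Submodule.span 𝔽 A) (h : ∀ T ∈ A, U * T ∈ N) : U * X ∈ N := by
  induction hX using Submodule.span_induction with
  | mem T hT => exact h T hT
  | zero => rw [mul_zero]; exact N.zero_mem
  | add T V _ _ hT hV => rw [mul_add]; exact N.add_mem hT hV
  | smul c T _ hT => rw [mul_smul_comm]; exact N.smul_mem c hT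

theorem neg_mem_of_mem {N : Submodule 𝔽 (Module.End 𝔽 (typeA 𝔽 n))}
    {T : Module.End 𝔽 (typeA 𝔽 n)} (h : T ∈ N) : -T ∈ N := by
  have e : -T = (-1 : 𝔽) • T := LinearMap.ext fun F => by
    rw [LinearMap.neg_apply, LinearMap.smul_apply, neg_one_smul]
  rw [e]
  exact N.smul_mem _ h

/-- Two commutators can be interchanged, at the cost of changing their second indices. -/
theorem ct_mul_ct_mem_span {m v i j : Fin n} (hmv : v ≠ m) (hij : j ≠ i) :
    ct 𝔽 m v * ct 𝔽 i j ∈ Submodule.span 𝔽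
      {T | ∃ j' v' : Fin n, j' ≠ i ∧ v' ≠ m ∧ T = ct 𝔽 i j' * ct 𝔽 m v'} := by
  -- The relation depends on the shared indices: reuse of x_i gives zero, m = j reverses a path, v =
  -- j is the exchange with common second index, and otherwise the letters commute.
  by_cases him : m = i ∨ v = i
  · rw [ct_mul_ct_eq_zero him]
    exact Submodule.zero_mem _
  · obtain ⟨him, hiv⟩ := not_or.mp him
    rcases eq_or_ne m j with rfl | hjm
    · rw [ct_mul_ct_chain him hiv hmv.symm]
      exact neg_mem_of_mem (Submodule.subset_span ⟨v, i, hiv, Ne.symm him, rfl⟩)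
    rcases eq_or_ne v j with rfl | hjv
    · rw [ct_mul_ct (Ne.symm him) hmv (Ne.symm hiv)]
      exact Submodule.add_mem _ (Submodule.subset_span ⟨v, v, hiv, hmv, rfl⟩)
        (Submodule.subset_span ⟨v, i, hiv, Ne.symm him, rfl⟩)
    · rw [ct_mul_comm him hjm hiv hjv]
      exact Submodule.subset_span ⟨j, v, hij, hmv, rfl⟩

/-- The letter is pushed through b one exchange at a time. First indices are preserved, so the
length and the eliminated variables do not change. -/
theorem ct_mul_wordOp_mem_span {m v : Fin n} (hmv : v ≠ m) (b : List (Fin n × Fin n))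
    (hb : ∀ p ∈ b, p.1 ≠ p.2) : ct 𝔽 m v * wordOp 𝔽 b ∈ Submodule.span 𝔽
      {T | ∃ (b' : List (Fin n × Fin n)) (v' : Fin n), b'.map Prod.fst = b.map Prod.fst ∧
        (∀ p ∈ b', p.1 ≠ p.2) ∧ v' ≠ m ∧ T = wordOp 𝔽 b' * ct 𝔽 m v'} := by
  induction b generalizing v with
  | nil => exact Submodule.subset_span ⟨[], v, rfl, by simp, hmv, by simp [wordOp_nil]⟩
  | cons p b ih =>
    rw [wordOp_cons, ← mul_assoc]
    refine mul_mem_of_mem_span_left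
      (ct_mul_ct_mem_span hmv (hb p List.mem_cons_self).symm) ?_
    rintro _ ⟨j, v', hj, hv', rfl⟩
    rw [mul_assoc]
    refine mul_mem_of_mem_span_right (ih hv' fun q hq => hb q (List.mem_cons_of_mem p hq)) ?_
    rintro _ ⟨b', v'', hfst, hb', hv'', rfl⟩
    refine Submodule.subset_span ⟨(p.1, j) :: b', v'', by simp [hfst], ?_, hv'', ?_⟩
    · intro q hq
      rcases List.mem_cons.mp hq with rfl | hq
      · exact hj.symm
      · exact hb' q hq
    · rw [wordOp_cons, mul_assoc]

theorem wordOp_mul_ct_mem_span {m v : Fin n} (hmv : v ≠ m) (a : List (Fin n × Fin n))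
    (ha : ∀ p ∈ a, p.1 ≠ p.2) : wordOp 𝔽 a * ct 𝔽 m v ∈ Submodule.span 𝔽
      {T | ∃ (a' : List (Fin n × Fin n)) (v' : Fin n), a'.map Prod.fst = a.map Prod.fst ∧
        (∀ p ∈ a', p.1 ≠ p.2) ∧ v' ≠ m ∧ T = ct 𝔽 m v' * wordOp 𝔽 a'} := by
  induction a with
  | nil => exact Submodule.subset_span ⟨[], v, rfl, by simp, hmv, by simp [wordOp_nil]⟩
  | cons p a ih =>
    rw [wordOp_cons, mul_assoc]
    refine mul_mem_of_mem_span_right (ih fun q hq => ha q (List.mem_cons_of_mem p hq)) ?_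
    rintro _ ⟨a', v', hfst, ha', hv', rfl⟩
    rw [← mul_assoc]
    refine mul_mem_of_mem_span_left
      (ct_mul_ct_mem_span (ha p List.mem_cons_self).symm hv') ?_
    rintro _ ⟨v'', j, hv'', hj, rfl⟩
    refine Submodule.subset_span ⟨(p.1, j) :: a', v'', by simp [hfst], ?_, hv'', ?_⟩
    · intro q hq
      rcases List.mem_cons.mp hq with rfl | hq
      · exact hj.symm
      · exact ha' q hq
    · rw [wordOp_cons, mul_assoc]

/-- A word is normal if the first indices increase and a second index is never the first index of a
later letter. -/
def IsNormal (w : List (Fin n × Fin n)) : Prop :=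
  (∀ p ∈ w, p.1 ≠ p.2) ∧ w.Pairwise fun p q => p.1 < q.1 ∧ p.2 ≠ q.1

/-- Every word is a combination of normal words with the same first indices. -/
theorem wordOp_mem_span_isNormal (w : List (Fin n × Fin n)) (hw : ∀ p ∈ w, p.1 ≠ p.2) :
    wordOp 𝔽 w ∈ Submodule.span 𝔽
      {T | ∃ w' : List (Fin n × Fin n), IsNormal w' ∧
        (w'.map Prod.fst).Perm (w.map Prod.fst) ∧ T = wordOp 𝔽 w'} := by
  induction hs : w.length generalizing w with
  | zero =>
    rw [List.length_eq_zero_iff] at hs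
    subst hs
    exact Submodule.subset_span ⟨[], ⟨by simp, List.Pairwise.nil⟩, List.Perm.refl _, rfl⟩
  | succ s ih =>
    have hne : (w.map Prod.fst).toFinset.Nonempty := by
      rw [List.toFinset_nonempty_iff]
      rintro h
      rw [List.map_eq_nil_iff] at h
      simp [h] at hs
    -- The letter with the largest first index goes to the right end, and the induction hypothesis
    -- normalizes what stands to its left.
    obtain ⟨m, hm, hmax⟩ := Finset.exists_max_image _ id hne
    obtain ⟨⟨_, v⟩, hp, rfl⟩ := List.mem_map.mp (List.mem_toFinset.mp hm)
    obtain ⟨a, b, rfl⟩ := List.append_of_mem hp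
    change ∀ x ∈ _, x ≤ _ at hmax
    rename_i m
    have hmv : v ≠ m := (hw (m, v) hp).symm
    rw [wordOp_append, wordOp_cons]
    have hb : ∀ p ∈ b, p.1 ≠ p.2 := fun p hp =>
      hw p (List.mem_append_right _ (List.mem_cons_of_mem _ hp))
    refine mul_mem_of_mem_span_right (ct_mul_wordOp_mem_span hmv b hb) ?_
    rintro _ ⟨b', v', hfst, hb', hv', rfl⟩
    rw [← mul_assoc, ← wordOp_append]
    have hlen : b'.length = b.length := by
      simpa using congrArg List.length hfst
    refine mul_mem_of_mem_span_left (ih (a ++ b') ?_ ?_) ?_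
    · intro q hq
      rcases List.mem_append.mp hq with hq | hq
      · exact hw q (List.mem_append_left _ hq)
      · exact hb' q hq
    · simp only [List.length_append, List.length_cons] at hs ⊢
      omega
    · rintro _ ⟨c, hc, hperm, rfl⟩
      rw [← wordOp_singleton (m, v'), ← wordOp_append]
      -- Zero words are discarded; in a nonzero word the condition on second indices is automatic,
      -- and the increase of the first indices comes from the maximality of m.
      by_cases h0 : wordOp 𝔽 (c ++ [(m, v')]) = 0
      · rw [h0]
        exact Submodule.zero_mem _
      obtain ⟨h1, h2⟩ := pairwise_of_wordOp_ne_zero h0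
      refine Submodule.subset_span ⟨_, ⟨h1, ?_⟩, ?_, rfl⟩
      · obtain ⟨-, -, h3⟩ := List.pairwise_append.mp h2
        refine List.pairwise_append.mpr ⟨hc.2, List.pairwise_singleton _ _, ?_⟩
        intro p hp q hq
        obtain ⟨h4, h5⟩ := h3 p hp q hq
        refine ⟨lt_of_le_of_ne ?_ h4, h5⟩
        rw [List.mem_singleton.mp hq]
        refine hmax p.1 (List.mem_toFinset.mpr ?_)
        have := hperm.subset (List.mem_map_of_mem hp)
        rw [List.map_append, hfst] at this
        rw [List.map_append, List.map_cons]
        simp only [List.mem_append, List.mem_cons] at this ⊢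
        tauto
      · rw [List.map_append, List.map_append, List.map_cons]
        rw [List.map_append, hfst] at hperm
        refine (hperm.append_right _).trans ?_
        simp only [List.map_cons, List.map_nil]
        exact (List.perm_append_singleton _ _).trans List.perm_middle.symm

/-- A word of length `n - 1` is a combination of words of the same length that do not eliminate a
given variable. -/
theorem wordOp_mem_span_notMem {w : List (Fin n × Fin n)} (hw : wordOp 𝔽 w ≠ 0)
    (hlen : w.length + 1 = n) (z : Fin n) : wordOp 𝔽 w ∈ Submodule.span 𝔽
      {T | ∃ w' : List (Fin n × Fin n), (∀ p ∈ w', p.1 ≠ p.2) ∧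
        w'.length = w.length ∧ z ∉ w'.map Prod.fst ∧ T = wordOp 𝔽 w'} := by
  obtain ⟨hdist, hpw⟩ := pairwise_of_wordOp_ne_zero hw
  by_cases hz : z ∈ w.map Prod.fst
  swap
  · exact Submodule.subset_span ⟨w, hdist, rfl, hz, rfl⟩
  have hnodup := nodup_of_wordOp_ne_zero hw
  obtain ⟨⟨z', v⟩, hp, hz'⟩ := List.mem_map.mp hz
  change z' = z at hz'
  subst z'
  obtain ⟨a, b, rfl⟩ := List.append_of_mem hp
  have hvz : v ≠ z := (hdist (z, v) hp).symm
  have ha : ∀ p ∈ a, p.1 ≠ p.2 := fun p hp => hdist p (List.mem_append_left _ hp)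
  -- The letter that eliminates x_z is moved to the left end, so that it acts last.
  rw [wordOp_append, wordOp_cons, ← mul_assoc]
  refine mul_mem_of_mem_span_left (wordOp_mul_ct_mem_span hvz a ha) ?_
  rintro _ ⟨a', v', hfst, ha', hv', rfl⟩
  rw [mul_assoc, ← wordOp_append]
  have hla : a'.length = a.length := by simpa using congrArg List.length hfst
  have hfst' : (a' ++ b).map Prod.fst = (a ++ b).map Prod.fst := by
    rw [List.map_append, List.map_append, hfst]
  have hnd : z ∉ (a' ++ b).map Prod.fst ∧ ((a' ++ b).map Prod.fst).Nodup := by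
    rw [hfst', ← List.nodup_cons, List.map_append]
    refine (List.perm_middle.nodup_iff).mp ?_
    simpa using hnodup
  by_cases hv : v' ∈ (a' ++ b).map Prod.fst
  · rw [ct_mul_wordOp_eq_zero _ (Or.inr hv)]
    exact Submodule.zero_mem _
  -- The other n - 2 letters leave a function of x_z and x_v' only. There [z,v'] = -[v',z], and x_v'
  -- can be eliminated in place of x_z.
  have hcompl : ((a' ++ b).map Prod.fst).toFinsetᶜ = {z, v'} := by
    symm
    refine Finset.eq_of_subset_of_card_le ?_ ?_
    · intro i hi
      rw [Finset.mem_compl, List.mem_toFinset]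
      rcases Finset.mem_insert.mp hi with rfl | hi
      · exact hnd.1
      · rw [Finset.mem_singleton.mp hi]
        exact hv
    · rw [Finset.card_compl, List.toFinset_card_of_nodup hnd.2, Finset.card_pair hv'.symm,
        Fintype.card_fin, List.length_map]
      simp only [List.length_append, List.length_cons] at hlen ⊢
      omega
  have hneg : ct 𝔽 z v' * wordOp 𝔽 (a' ++ b) = -wordOp 𝔽 ((v', z) :: (a' ++ b)) := by
    refine LinearMap.ext fun F => ?_
    have hF := wordOp_apply_mem (a' ++ b) F
    rw [hcompl] at hF
    rw [wordOp_cons]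
    exact ct_eq_neg_ct_swap hv'.symm hF
  rw [hneg]
  refine neg_mem_of_mem (Submodule.subset_span ⟨_, ?_, ?_, ?_, rfl⟩)
  · intro q hq
    rcases List.mem_cons.mp hq with rfl | hq
    · exact hv'
    · rcases List.mem_append.mp hq with hq | hq
      · exact ha' q hq
      · exact hdist q (List.mem_append_right _ (List.mem_cons_of_mem _ hq))
  · simp only [List.length_append, List.length_cons, hla]
    omega
  · rw [List.map_cons, List.mem_cons, not_or]
    exact ⟨hv'.symm, hnd.1⟩

/-- Words with the same letters agree if letters that do not commute appear in the same order. -/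
theorem wordOp_eq_of_perm {w w' : List (Fin n × Fin n)} (hp : w.Perm w')
    (h : w.Pairwise fun p q => p.1 ≠ q.1 ∧ p.2 ≠ q.1 ∧ (p.2 = q.2 → p.1 < q.1))
    (h' : w'.Pairwise fun p q => p.1 ≠ q.1 ∧ p.2 ≠ q.1 ∧ (p.2 = q.2 → p.1 < q.1)) :
    wordOp 𝔽 w = wordOp 𝔽 w' := by
  induction w generalizing w' with
  | nil => rw [hp.nil_eq]
  | cons p w ih =>
    obtain ⟨a, b, rfl⟩ := List.append_of_mem (hp.subset List.mem_cons_self)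
    have hp' : w.Perm (a ++ b) := (hp.trans List.perm_middle).cons_inv
    obtain ⟨hpw, hw⟩ := List.pairwise_cons.mp h
    have hab := h'.sublist ((List.sublist_cons_self p b).append_left a)
    -- A letter q of a stands after p in one word and before it in the other. The two order
    -- conditions together exclude every shared index, so p and q commute.
    have hcomm : ct 𝔽 p.1 p.2 * wordOp 𝔽 a = wordOp 𝔽 a * ct 𝔽 p.1 p.2 := by
      have hq : ∀ q ∈ a, Commute (ct 𝔽 p.1 p.2) (ct 𝔽 q.1 q.2) := by
        intro q hqa
        obtain ⟨h1, h2, h3⟩ := (List.pairwise_append.mp h').2.2 q hqa p List.mem_cons_self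
        obtain ⟨h4, h5, h6⟩ := hpw q (hp'.symm.subset (List.mem_append_left _ hqa))
        exact ct_mul_comm h4 h2.symm h5 fun e => lt_asymm (h6 e) (h3 e.symm)
      refine (Commute.list_prod_right _ _ fun T hT => ?_).eq
      obtain ⟨q, hqa, rfl⟩ := List.mem_map.mp hT
      exact hq q hqa
    rw [wordOp_cons, ih hp' hw hab, wordOp_append, wordOp_append, wordOp_cons, ← mul_assoc, hcomm,
      mul_assoc]

end Rewriting

/-! ### Reading the edges of a forest -/

namespace OrderedDigraph

variable {n : ℕ} {D : OrderedDigraph n}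

theorem mem_level_succ {r v : Fin n} {k : ℕ} :
    v ∈ D.level r (k + 1) ↔ ∃ p ∈ D.level r k, v ∈ D.children p := by
  rw [level, List.mem_flatMap]

/-- Parents are unique and roots have none, so both descriptions of v climb through the same
vertices. -/
theorem level_unique (hD : D.IsForest) {r r' v : Fin n} (hr : D.IsRoot r) (hr' : D.IsRoot r')
    {k k' : ℕ} (h : v ∈ D.level r k) (h' : v ∈ D.level r' k') : r = r' ∧ k = k' := by
  induction k generalizing v k' with
  | zero =>
    rw [level, List.mem_singleton] at h
    subst h
    rcases k' with _ | k'
    · rw [level, List.mem_singleton] at h'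
      exact ⟨h', rfl⟩
    · obtain ⟨p, -, hp⟩ := mem_level_succ.mp h'
      exact absurd hp (hr p)
  | succ k ih =>
    obtain ⟨p, hpl, hp⟩ := mem_level_succ.mp h
    rcases k' with _ | k'
    · rw [level, List.mem_singleton] at h'
      subst h'
      exact absurd hp (hr' p)
    · obtain ⟨p', hpl', hp'⟩ := mem_level_succ.mp h'
      obtain rfl := hD.out_unique v p p' hp hp'
      obtain ⟨e, e'⟩ := ih hpl hpl'
      exact ⟨e, by rw [e']⟩

theorem level_nodup (hD : D.IsForest) (r : Fin n) (k : ℕ) : (D.level r k).Nodup := by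
  induction k with
  | zero => exact List.nodup_singleton r
  | succ k ih =>
    rw [level, List.nodup_flatMap]
    refine ⟨fun v _ => hD.nodup v, ih.imp fun {p q} hpq => ?_⟩
    intro v hp hq
    exact hpq (hD.out_unique v p q hp hq)

/-- `treeWord` reads only the levels below n, so depths must be bounded. Labels decrease on the way
up until the root is reached; the last step, into the root, accounts for the extra 1. -/
theorem exists_mem_level (hD : D.NearlyIncreasing) (v : Fin n) :
    ∃ r k, D.IsRoot r ∧ v ∈ D.level r k ∧ (D.IsRoot v → k = 0) ∧ k ≤ (v : ℕ) + 1 := by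
  induction v using WellFoundedLT.induction with
  | _ v ih =>
    by_cases hv : D.IsRoot v
    · exact ⟨v, 0, hv, List.mem_singleton_self v, fun _ => rfl, Nat.zero_le _⟩
    · have hv' := hv
      rw [IsRoot, not_forall] at hv'
      obtain ⟨p, hp⟩ := hv'
      have hp := not_not.mp hp
      by_cases hr : D.IsRoot p
      · exact ⟨p, 1, hr, mem_level_succ.mpr ⟨p, List.mem_singleton_self p, hp⟩,
          fun h => absurd h hv, Nat.le_add_left _ _⟩
      · have hlt := hD v p hp hr
        obtain ⟨r, k, hr, hk, -, hle⟩ := ih p hlt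
        refine ⟨r, k + 1, hr, mem_level_succ.mpr ⟨p, hk, hp⟩, fun h => absurd h hv, ?_⟩
        omega

/-- The vertices of a forest, tree after tree and level by level. -/
def vertices (D : OrderedDigraph n) : List (Fin n) :=
  ((List.finRange n).filter fun r => D.IsRoot r).flatMap fun r =>
    (List.range n).flatMap (D.level r)

theorem word_eq (D : OrderedDigraph n) :
    D.word = D.vertices.flatMap fun v => (D.children v).map fun u => (u, v) := by
  simp only [word, vertices, List.flatMap_assoc]
  rfl

theorem mem_vertices {v : Fin n} :
    v ∈ D.vertices ↔ ∃ r, D.IsRoot r ∧ ∃ k < n, v ∈ D.level r k := by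
  simp [vertices, List.mem_flatMap, List.mem_filter]

theorem mem_word (hD : D.NearlyIncreasing) {p : Fin n × Fin n} :
    p ∈ D.word ↔ D.Edge p.1 p.2 := by
  obtain ⟨u, v⟩ := p
  rw [word_eq, List.mem_flatMap]
  constructor
  · rintro ⟨v', -, h⟩
    obtain ⟨u', hu', e⟩ := List.mem_map.mp h
    obtain ⟨rfl, rfl⟩ := Prod.mk.inj e
    exact hu'
  · intro h
    refine ⟨v, mem_vertices.mpr ?_, List.mem_map.mpr ⟨u, h, rfl⟩⟩
    obtain ⟨r, k, hr, hv, h0, hk⟩ := exists_mem_level hD v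
    refine ⟨r, hr, k, ?_, hv⟩
    by_cases hvr : D.IsRoot v
    · rw [h0 hvr]
      exact v.pos
    -- A vertex with a child u satisfies v < u < n if it is not a root, so its depth, at most v + 1,
    -- is less than n.
    · have := hD u v h hvr
      have := u.2
      omega

/-- A child lies in the same tree as its parent, exactly one level further from the root, and so is
read later. -/
theorem vertices_pairwise (hD : D.IsForest) :
    D.vertices.Pairwise fun v v' => v ≠ v' ∧ v ∉ D.children v' := by
  have key : ∀ {r r' v v' : Fin n} {k k' : ℕ}, D.IsRoot r → D.IsRoot r' → v ∈ D.level r k →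
      v' ∈ D.level r' k' → (r ≠ r' ∨ k < k') → v ≠ v' ∧ v ∉ D.children v' := by
    intro r r' v v' k k' hr hr' hv hv' h
    constructor
    · rintro rfl
      obtain ⟨e, e'⟩ := level_unique hD hr hr' hv hv'
      rcases h with h | h
      · exact h e
      · omega
    · intro hc
      obtain ⟨e, e'⟩ := level_unique hD hr hr' hv (mem_level_succ.mpr ⟨v', hv', hc⟩)
      rcases h with h | h
      · exact h e
      · omega
  have hroot : ∀ {r : Fin n}, r ∈ (List.finRange n).filter (fun r => D.IsRoot r) → D.IsRoot r :=
    fun h => by simpa using h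
  refine List.pairwise_flatMap.mpr ⟨fun r hr => List.pairwise_flatMap.mpr ⟨fun k _ => ?_, ?_⟩, ?_⟩
  · refine (level_nodup hD r k).imp_of_mem fun {v v'} hv hv' hne => ⟨hne, fun hc => ?_⟩
    have := (level_unique hD (hroot hr) (hroot hr) hv (mem_level_succ.mpr ⟨v', hv', hc⟩)).2
    omega
  · exact List.pairwise_lt_range.imp fun {k k'} hk v hv v' hv' =>
      key (hroot hr) (hroot hr) hv hv' (Or.inr hk)
  · refine ((List.nodup_finRange n).filter _).imp_of_mem fun {r r'} hr hr' hne v hv v' hv' => ?_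
    obtain ⟨k, -, hv⟩ := List.mem_flatMap.mp hv
    obtain ⟨k', -, hv'⟩ := List.mem_flatMap.mp hv'
    exact key (hroot hr) (hroot hr') hv hv' (Or.inl hne)

/-- This is the order condition of `wordOp_eq_of_perm`: augmentation orders siblings, and
`vertices_pairwise` handles edges into different vertices. -/
theorem word_pairwise (hD : D.IsForest) (ha : D.Augmented) :
    D.word.Pairwise fun p q => p.1 ≠ q.1 ∧ p.2 ≠ q.1 ∧ (p.2 = q.2 → p.1 < q.1) := by
  rw [word_eq]
  refine List.pairwise_flatMap.mpr ⟨fun v _ => List.pairwise_map.mpr ?_, ?_⟩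
  · refine (ha v).imp_of_mem fun {u u'} _ hu' h => ⟨h.ne, ?_, fun _ => h⟩
    rintro rfl
    exact hD.acyclic _ (Relation.TransGen.single hu')
  · refine (vertices_pairwise hD).imp ?_
    rintro v v' ⟨hne, hc⟩ p hp q hq
    obtain ⟨u, hu, rfl⟩ := List.mem_map.mp hp
    obtain ⟨u', hu', rfl⟩ := List.mem_map.mp hq
    refine ⟨?_, ?_, fun h => absurd h hne⟩
    · rintro rfl
      exact hne (hD.out_unique _ v v' hu hu')
    · rintro rfl
      exact hc hu'

theorem nodup_of_word_pairwise {w : List (Fin n × Fin n)}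
    (h : w.Pairwise fun p q => p.1 ≠ q.1 ∧ p.2 ≠ q.1 ∧ (p.2 = q.2 → p.1 < q.1)) : w.Nodup :=
  h.imp fun h e => h.1 (congrArg Prod.fst e)

theorem length_word (hD : D.IsForest) (ha : D.Augmented) (hni : D.NearlyIncreasing) :
    D.word.length = D.edgeCount := by
  have hp : D.word.Perm
      ((List.finRange n).flatMap fun v => (D.children v).map fun u => (u, v)) := by
    refine (List.perm_ext_iff_of_nodup (nodup_of_word_pairwise (word_pairwise hD ha)) ?_).mpr ?_
    · refine List.nodup_flatMap.mpr ⟨fun v _ => (hD.nodup v).map (Prod.mk_left_injective v), ?_⟩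
      refine (List.nodup_finRange n).imp fun {v v'} hne p hp hq => hne ?_
      obtain ⟨u, -, rfl⟩ := List.mem_map.mp hp
      obtain ⟨u', -, e⟩ := List.mem_map.mp hq
      exact (congrArg Prod.snd e).symm
    · rintro ⟨u, v⟩
      rw [mem_word hni]
      simp [Edge]
  rw [hp.length_eq, List.length_flatMap, edgeCount, Fin.sum_univ_def]
  simp

theorem Increasing.nearlyIncreasing (h : D.Increasing) : D.NearlyIncreasing :=
  fun i j hij _ => h i j hij

/-- The digraph with the letters of a word as its edges. -/
def ofWord (w : List (Fin n × Fin n)) : OrderedDigraph n where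
  children v := (w.filter fun p => p.2 = v).map Prod.fst

theorem edge_ofWord {w : List (Fin n × Fin n)} {i j : Fin n} :
    (ofWord w).Edge i j ↔ (i, j) ∈ w := by
  simp [Edge, ofWord, List.mem_map, List.mem_filter]

end OrderedDigraph

open OrderedDigraph

/-! ### Normal words as augmented nearly increasing forests -/

section Normal

variable {n : ℕ} {w : List (Fin n × Fin n)}

/-- Normality forbids (i,j) to stand before (j,k), so it stands after it, and first indices
increase. -/
theorem IsNormal.lt_of_mem (hw : IsNormal w) {i j k : Fin n} (h : (i, j) ∈ w) (h' : (j, k) ∈ w) :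
    j < i := by
  obtain ⟨s, hs, e⟩ := List.mem_iff_getElem.mp h
  obtain ⟨t, ht, e'⟩ := List.mem_iff_getElem.mp h'
  have hp := List.pairwise_iff_getElem.mp hw.2
  rcases lt_trichotomy s t with hst | rfl | hst
  · have := hp s t hs ht hst
    rw [e, e'] at this
    exact absurd rfl this.2
  · rw [e] at e'
    exact absurd (congrArg Prod.fst e') (hw.1 _ h)
  · have := hp t s ht hs hst
    rw [e, e'] at this
    exact this.1

theorem IsNormal.augmented (hw : IsNormal w) : (ofWord w).Augmented := fun _ =>
  List.pairwise_map.mpr ((hw.2.imp fun h => h.1).filter _)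

theorem IsNormal.nearlyIncreasing (hw : IsNormal w) : (ofWord w).NearlyIncreasing := by
  intro i j hij hj
  rw [IsRoot, not_forall] at hj
  obtain ⟨k, hk⟩ := hj
  exact hw.lt_of_mem (edge_ofWord.mp hij) (edge_ofWord.mp (not_not.mp hk))

theorem IsNormal.isForest (hw : IsNormal w) : (ofWord w).IsForest where
  nodup v := (hw.augmented v).imp fun h => h.ne
  out_unique i j k hj hk := by
    have hnd : (w.map Prod.fst).Nodup := List.pairwise_map.mpr (hw.2.imp fun h => h.1.ne)
    exact congrArg Prod.snd
      (List.inj_on_of_nodup_map hnd (edge_ofWord.mp hj) (edge_ofWord.mp hk) rfl)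
  acyclic i hi := by
    -- Along a path from i the labels stay below i until a root is reached, where the path ends; so
    -- it cannot return to i.
    have key : ∀ j, Relation.TransGen (ofWord w).Edge i j → (ofWord w).IsRoot j ∨ j < i := by
      intro j hj
      induction hj with
      | @single k h =>
        by_cases hr : (ofWord w).IsRoot k
        · exact Or.inl hr
        · exact Or.inr (hw.nearlyIncreasing _ _ h hr)
      | @tail _ k _ h ih =>
        by_cases hr : (ofWord w).IsRoot k
        · exact Or.inl hr
        · exact Or.inr ((hw.nearlyIncreasing _ _ h hr).trans (ih.resolve_left fun h' => h' _ h))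
    rcases key i hi with h | h
    · obtain ⟨j, hj, -⟩ := Relation.TransGen.head'_iff.mp hi
      exact h j hj
    · exact lt_irrefl i h

theorem IsNormal.pairwise (hw : IsNormal w) :
    w.Pairwise fun p q => p.1 ≠ q.1 ∧ p.2 ≠ q.1 ∧ (p.2 = q.2 → p.1 < q.1) :=
  hw.2.imp fun h => ⟨h.1.ne, h.2, fun _ => h.1⟩

theorem IsNormal.perm_word (hw : IsNormal w) : w.Perm (ofWord w).word := by
  refine (List.perm_ext_iff_of_nodup (nodup_of_word_pairwise hw.pairwise)
    (nodup_of_word_pairwise (word_pairwise hw.isForest hw.augmented))).mpr fun p => ?_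
  rw [mem_word hw.nearlyIncreasing, edge_ofWord]

theorem IsNormal.mem_basisSet (𝔽 : Type*) [Field 𝔽] (hw : IsNormal w) {s : ℕ} (hs : w.length = s)
    (h : s + 1 = n → ∃ z : Fin n, (∀ i, z ≤ i) ∧ z ∉ w.map Prod.fst) :
    wordOp 𝔽 w ∈ basisSet 𝔽 n s := by
  refine ⟨ofWord w, hw.isForest, ?_, hw.augmented, ?_, ?_⟩
  · rw [← length_word hw.isForest hw.augmented hw.nearlyIncreasing, ← hw.perm_word.length_eq, hs]
  · split_ifs with hsn
    · obtain ⟨z, hz, hzw⟩ := h hsn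
      intro i j hij
      by_cases hr : (ofWord w).IsRoot j
      · have hnd : (w.map Prod.fst).Nodup := List.pairwise_map.mpr (hw.2.imp fun h => h.1.ne)
        -- A word of length n - 1 leaves a single index, so the only root is the least vertex z, and
        -- edges into it are increasing too.
        have hcard : ((w.map Prod.fst).toFinsetᶜ).card ≤ 1 := by
          rw [Finset.card_compl, List.toFinset_card_of_nodup hnd, List.length_map,
            Fintype.card_fin]
          omega
        have hj : j ∉ w.map Prod.fst := by
          intro hj
          obtain ⟨⟨_, k⟩, hk, rfl⟩ := List.mem_map.mp hj
          exact hr k (edge_ofWord.mpr hk)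
        have hjz : j = z := Finset.card_le_one.mp hcard j (by simpa using hj) z (by simpa using hzw)
        refine lt_of_le_of_ne (hjz ▸ hz i) ?_
        rintro rfl
        exact hr j hij
      · exact hw.nearlyIncreasing i j hij hr
    · exact hw.nearlyIncreasing
  · exact wordOp_eq_of_perm hw.perm_word hw.pairwise (word_pairwise hw.isForest hw.augmented)

end Normal

/-! ### Equality of Ξ^s with the span of B^s -/

section Main

variable {𝔽 : Type*} [Field 𝔽] {n : ℕ}

theorem span_basisSet_le (s : ℕ) : Submodule.span 𝔽 (basisSet 𝔽 n s) ≤ XiDeg 𝔽 n s := by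
  refine Submodule.span_le.mpr ?_
  rintro _ ⟨D, hD, hs, ha, hinc, rfl⟩
  have hni : D.NearlyIncreasing := by
    split_ifs at hinc with hsn
    · exact Increasing.nearlyIncreasing hinc
    · exact hinc
  -- Monomial operators are nonzero by definition, but a vanishing realization lies in every
  -- subspace.
  by_cases h0 : realization 𝔽 D = 0
  · rw [h0]
    exact Submodule.zero_mem _
  · refine Submodule.subset_span ⟨h0, D.word, fun p hp e => ?_, ?_, rfl⟩
    · have := (mem_word hni).mp hp
      rw [e] at this
      exact hD.acyclic _ (Relation.TransGen.single this)
    · rw [length_word hD ha hni, hs]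

theorem XiDeg_le_span_basisSet (s : ℕ) : XiDeg 𝔽 n s ≤ Submodule.span 𝔽 (basisSet 𝔽 n s) := by
  refine Submodule.span_le.mpr ?_
  rintro _ ⟨h0, w, hw, hs, rfl⟩
  by_cases hsn : s + 1 = n
  · have hn : 0 < n := by omega
    -- In top degree the least index 0 is first kept from being eliminated. Normalization only
    -- permutes the first indices, so 0 remains the root.
    refine (Submodule.span_le.mpr ?_)
      (wordOp_mem_span_notMem h0 (by rw [hs]; exact hsn) (⟨0, hn⟩ : Fin n))
    rintro _ ⟨w', hw', hlen, hz, rfl⟩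
    refine (Submodule.span_le.mpr ?_) (wordOp_mem_span_isNormal w' hw')
    rintro _ ⟨c, hc, hperm, rfl⟩
    refine Submodule.subset_span (hc.mem_basisSet 𝔽 ?_ fun _ => ⟨⟨0, hn⟩, ?_, ?_⟩)
    · have := hperm.length_eq
      simp only [List.length_map] at this
      rw [this, hlen, hs]
    · intro i
      exact Fin.mk_le_of_le_val (Nat.zero_le _)
    · exact fun h => hz (hperm.subset h)
  · refine (Submodule.span_le.mpr ?_) (wordOp_mem_span_isNormal w hw)
    rintro _ ⟨c, hc, hperm, rfl⟩
    refine Submodule.subset_span (hc.mem_basisSet 𝔽 ?_ fun h => absurd h hsn)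
    have := hperm.length_eq
    simp only [List.length_map] at this
    rw [this, hs]

/-- `Ξ^s` is spanned by `B^s`. -/
theorem XiDeg_eq_span_basisSet (s : ℕ) : XiDeg 𝔽 n s = Submodule.span 𝔽 (basisSet 𝔽 n s) :=
  le_antisymm (XiDeg_le_span_basisSet s) (span_basisSet_le s)

end Main

end CTAlg
end

theorem lemma3p14 (𝔽 : Type*) [Field 𝔽] [CharZero 𝔽] (n : ℕ) (hn : 1 ≤ n) :
    (iSupIndep (fun s : Fin n => CTAlg.XiDeg 𝔽 n s) ∧
      ⨆ s : Fin n, CTAlg.XiDeg 𝔽 n s = Subalgebra.toSubmodule (CTAlg.Xi 𝔽 n)) ∧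
    (iSupIndep (fun s : Fin n => Submodule.span 𝔽 (CTAlg.basisSet 𝔽 n s)) ∧
      ⨆ s : Fin n, Submodule.span 𝔽 (CTAlg.basisSet 𝔽 n s) =
        Subalgebra.toSubmodule (CTAlg.Xi 𝔽 n)) ∧
    ∀ s : Fin n, CTAlg.XiDeg 𝔽 n s = Submodule.span 𝔽 (CTAlg.basisSet 𝔽 n s) := by
  have h1 : iSupIndep (fun s : Fin n => CTAlg.XiDeg 𝔽 n s) := CTAlg.iSupIndep_XiDeg
  have h2 := CTAlg.iSup_XiDeg (𝔽 := 𝔽) hn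
  refine ⟨⟨h1, h2⟩, ?_, fun s => CTAlg.XiDeg_eq_span_basisSet s⟩
  simp only [CTAlg.XiDeg_eq_span_basisSet] at h1 h2
  exact ⟨h1, h2⟩
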